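/- Let $A$ be a finite-dimensional algebra over a field, let $\mathscr{A}=A\text{-mod}$ be the category of finitely generated left $A$-modules, and let $\mathscr{C}$ be a full additive subcategory of $\mathscr{A}$, closed under direct summands, such that every $M\in\mathscr{A}$ has a right $\mathscr{C}$-approximation (that is, $\mathscr{C}$ is contravariantly finite: there is $f\colon C\to M$ with $C\in\mathscr{C}$ through which every map from an object of $\mathscr{C}$ to $M$ factors) and every right $\mathscr{C}$-approximation is epic ($\mathscr{C}$ is admissible). A complex $X^\bullet$ is called $\mathscr{C}$-acyclic, or $\operatorname{Hom}(\mathscr{C},-)$-exact, if $\operatorname{Hom}_{\mathscr{A}}(C,X^\bullet)$ is acyclic for all $C\in\mathscr{C}$; $\operatorname{Hom}(-,\mathscr{C})$-exactness is defined dually. Let $\mathscr{G}(\mathscr{C})$ be the full subcategory of the modules $M\cong\operatorname{Im}(C^{-1}\to C^0)$ for some acyclic complex $\cdots\to C^{-1}\to C^0\to C^1\to\cdots$ with terms in $\mathscr{C}$ that is both $\operatorname{Hom}(\mathscr{C},-)$-exact and $\operatorname{Hom}(-,\mathscr{C})$-exact, and let $\varepsilon$ be the class of $\operatorname{Hom}(\mathscr{C},-)$-exact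 complexes $0\to L\to M\to N\to 0$ with $L,M,N\in\mathscr{G}(\mathscr{C})$. The $\mathscr{C}$-proper $\mathscr{G}(\mathscr{C})$-dimension of a module $M$ is the least $n\ge 0$ for which there is a $\operatorname{Hom}(\mathscr{C},-)$-exact complex $0\to G^{-n}\to\cdots\to G^0\to M\to 0$ with all $G^i\in\mathscr{G}(\mathscr{C})$ ($\infty$ if there is none), and that of $\mathscr{A}$ is the supremum over all $M\in\mathscr{A}$. Let $D^b_{\mathscr{C}}(\mathscr{A})$ be the Verdier quotient of the bounded homotopy category $K^b(\mathscr{A})$ by the $\mathscr{C}$-acyclic complexes, let $D_{\mathscr{C}\text{-sg}}(\mathscr{A})=D^b_{\mathscr{C}}(\mathscr{A})/K^b(\mathscr{C})$ be the Verdier quotient by the full triangulated subcategory $K^b(\mathscr{C})$, and let $\theta\colon\mathscr{G}(\mathscr{C})\hookrightarrow\mathscr{A}\to K^b(\mathscr{A})\to D^b_{\mathscr{C}}(\mathscr{A})\to D_{\mathscr{C}\text{-sg}}(\mathscr{A})$ be the natural functor, where a module is regarded as a complex concentrated in degree $0$. If the $\mathscr{C}$-proper $\mathscr{G}(\mathscr{C})$-dimension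 of $\mathscr{A}$ is finite, then $(\mathscr{G}(\mathscr{C}),\varepsilon)$ is a Frobenius category, its stable category $\underline{\mathscr{G}(\mathscr{C})}$ (the quotient of $\mathscr{G}(\mathscr{C})$ by the morphisms that factor through $\varepsilon$-projective objects) is a triangulated category with Happel's shift and distinguished triangles, and $\theta$ induces a triangle equivalence $\theta'\colon\underline{\mathscr{G}(\mathscr{C})}\to D_{\mathscr{C}\text{-sg}}(\mathscr{A})$. -/

import Mathlib

open CategoryTheory Limits Pretriangulated Opposite ZeroObject

universe v u w

noncomputable section

/-! ### Finite-dimensional modules over a finite-dimensional algebra -/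

/-- The category `A`-mod of finitely generated left modules over a finite-dimensional
algebra `A` over the field `k`. -/
def FDModuleCat (k : Type w) (A : Type u) [Field k] [Ring A] [Algebra k A]
    [FiniteDimensional k A] : Type (u + 1) :=
  FGModuleCat.{u} A

instance (k : Type w) (A : Type u) [Field k] [Ring A] [Algebra k A] [FiniteDimensional k A] :
    Category.{u} (FDModuleCat k A) :=
  inferInstanceAs (Category.{u} (FGModuleCat.{u} A))

instance (k : Type w) (A : Type u) [Field k] [Ring A] [Algebra k A] [FiniteDimensional k A] :
    Abelian (FDModuleCat k A) :=
  haveI : IsNoetherianRing A := IsNoetherianRing.of_finite k A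
  inferInstanceAs (Abelian (FGModuleCat.{u} A))

namespace RelSing

/-! ### Exact categories, Frobenius categories, stable categories -/

section Exact

variable {B : Type u} [Category.{v} B] [Preadditive B]

/-- Admissible monics with respect to a class `ε` of short complexes. -/
def IsInflation (ε : ObjectProperty (ShortComplex B)) {X Y : B} (i : X ⟶ Y) : Prop :=
  ∃ (Z : B) (p : Y ⟶ Z) (h : i ≫ p = 0), ε (ShortComplex.mk i p h)

/-- Admissible epics with respect to a class `ε` of short complexes. -/
def IsDeflation (ε : ObjectProperty (ShortComplex B)) {Y Z : B} (p : Y ⟶ Z) : Prop :=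
  ∃ (X : B) (i : X ⟶ Y) (h : i ≫ p = 0), ε (ShortComplex.mk i p h)

/-- The axioms of a (Quillen) exact category for the class `ε` of conflations. -/
structure IsExactStructure (ε : ObjectProperty (ShortComplex B)) : Prop where
  of_iso {S T : ShortComplex B} (e : S ≅ T) (hS : ε S) : ε T
  isKernel (S : ShortComplex B) (hS : ε S) : Nonempty (IsLimit (KernelFork.ofι S.f S.zero))
  isCokernel (S : ShortComplex B) (hS : ε S) : Nonempty (IsColimit (CokernelCofork.ofπ S.g S.zero))
  id_inflation (X : B) : IsInflation ε (𝟙 X)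
  id_deflation (X : B) : IsDeflation ε (𝟙 X)
  comp_inflation {X Y Z : B} (f : X ⟶ Y) (g : Y ⟶ Z) (hf : IsInflation ε f)
    (hg : IsInflation ε g) : IsInflation ε (f ≫ g)
  comp_deflation {X Y Z : B} (f : X ⟶ Y) (g : Y ⟶ Z) (hf : IsDeflation ε f)
    (hg : IsDeflation ε g) : IsDeflation ε (f ≫ g)
  pushout_inflation {X Y X' : B} (i : X ⟶ Y) (f : X ⟶ X') (hi : IsInflation ε i) :
    ∃ (Y' : B) (f' : Y ⟶ Y') (i' : X' ⟶ Y'), IsPushout i f f' i' ∧ IsInflation ε i'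
  pullback_deflation {Y Z Z' : B} (p : Y ⟶ Z) (f : Z' ⟶ Z) (hp : IsDeflation ε p) :
    ∃ (Y' : B) (f' : Y' ⟶ Y) (p' : Y' ⟶ Z'), IsPullback f' p' p f ∧ IsDeflation ε p'

/-- Projective objects relative to `ε`. -/
def IsRelProjective (ε : ObjectProperty (ShortComplex B)) (P : B) : Prop :=
  ∀ ⦃Y Z : B⦄ (p : Y ⟶ Z) (_ : IsDeflation ε p) (f : P ⟶ Z), ∃ g : P ⟶ Y, g ≫ p = f

/-- Injective objects relative to `ε`. -/
def IsRelInjective (ε : ObjectProperty (ShortComplex B)) (I : B) : Prop :=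
  ∀ ⦃X Y : B⦄ (i : X ⟶ Y) (_ : IsInflation ε i) (f : X ⟶ I), ∃ g : Y ⟶ I, i ≫ g = f

/-- `(B, ε)` is a Frobenius category: an exact category with enough projectives and
enough injectives in which the projective and the injective objects coincide. -/
structure IsFrobenius (ε : ObjectProperty (ShortComplex B)) : Prop where
  exact : IsExactStructure ε
  enough_projectives (X : B) : ∃ (P : B) (p : P ⟶ X), IsRelProjective ε P ∧ IsDeflation ε p
  enough_injectives (X : B) : ∃ (I : B) (i : X ⟶ I), IsRelInjective ε I ∧ IsInflation ε i
  projective_iff_injective (X : B) : IsRelProjective ε X ↔ IsRelInjective ε X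

/-- Two morphisms are stably equal if their difference factors through a projective object. -/
def stableRel (ε : ObjectProperty (ShortComplex B)) : HomRel B := fun X Y f g =>
  ∃ (P : B) (a : X ⟶ P) (b : P ⟶ Y), IsRelProjective ε P ∧ f - g = a ≫ b

/-- The stable category of `(B, ε)`. -/
abbrev StableCategory (ε : ObjectProperty (ShortComplex B)) : Type u :=
  CategoryTheory.Quotient (stableRel ε)

/-- The canonical functor to the stable category. -/
abbrev stableQuotient (ε : ObjectProperty (ShortComplex B)) : B ⥤ StableCategory ε :=
  CategoryTheory.Quotient.functor (stableRel ε)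

lemma isRelProjective_biprod {ε : ObjectProperty (ShortComplex B)} [HasBinaryBiproducts B]
    {P Q : B} (hP : IsRelProjective ε P) (hQ : IsRelProjective ε Q) :
    IsRelProjective ε (P ⊞ Q) := by
  intro Y Z p hp f
  obtain ⟨g₁, h₁⟩ := hP p hp (biprod.inl ≫ f)
  obtain ⟨g₂, h₂⟩ := hQ p hp (biprod.inr ≫ f)
  exact ⟨biprod.desc g₁ g₂, by ext <;> simp [h₁, h₂]⟩

lemma isRelProjective_zero (ε : ObjectProperty (ShortComplex B)) [HasZeroObject B] :
    IsRelProjective ε (0 : B) :=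
  fun _ _ _ _ _ => ⟨0, (isZero_zero B).eq_of_src _ _⟩

lemma stableRel_add (ε : ObjectProperty (ShortComplex B)) [HasBinaryBiproducts B]
    ⦃X Y : B⦄ (f₁ f₂ g₁ g₂ : X ⟶ Y) (hf : stableRel ε f₁ f₂) (hg : stableRel ε g₁ g₂) :
    stableRel ε (f₁ + g₁) (f₂ + g₂) := by
  obtain ⟨P, a, b, hP, h⟩ := hf
  obtain ⟨Q, c, d, hQ, h'⟩ := hg
  refine ⟨P ⊞ Q, biprod.lift a c, biprod.desc b d, isRelProjective_biprod hP hQ, ?_⟩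
  rw [biprod.lift_desc, ← h, ← h']
  abel

instance (ε : ObjectProperty (ShortComplex B)) [HasZeroObject B] [HasBinaryBiproducts B] :
    Congruence (stableRel ε) where
  comp_left := by
    rintro X Y Z f g g' ⟨P, a, b, hP, h⟩
    exact ⟨P, f ≫ a, b, hP, by rw [← Preadditive.comp_sub, h, Category.assoc]⟩
  comp_right := by
    rintro X Y Z f f' g ⟨P, a, b, hP, h⟩
    exact ⟨P, a, b ≫ g, hP, by rw [← Preadditive.sub_comp, h, Category.assoc]⟩
  equivalence :=
    { refl := fun _ => ⟨0, 0, 0, isRelProjective_zero ε, by simp⟩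
      symm := by
        rintro f g ⟨P, a, b, hP, h⟩
        exact ⟨P, -a, b, hP, by rw [Preadditive.neg_comp, ← h, neg_sub]⟩
      trans := by
        rintro f g k ⟨P, a, b, hP, h⟩ ⟨Q, c, d, hQ, h'⟩
        refine ⟨P ⊞ Q, biprod.lift a c, biprod.desc b d, isRelProjective_biprod hP hQ, ?_⟩
        rw [biprod.lift_desc, ← h, ← h']
        abel }

instance (ε : ObjectProperty (ShortComplex B)) [HasZeroObject B] [HasBinaryBiproducts B] :
    Preadditive (StableCategory ε) :=
  CategoryTheory.Quotient.preadditive _ (stableRel_add ε)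

instance (ε : ObjectProperty (ShortComplex B)) [HasZeroObject B] [HasBinaryBiproducts B] :
    (stableQuotient ε).Additive :=
  CategoryTheory.Quotient.functor_additive _ (stableRel_add ε)

instance (ε : ObjectProperty (ShortComplex B)) [HasZeroObject B] [HasBinaryBiproducts B] :
    HasZeroObject (StableCategory ε) :=
  ⟨(stableQuotient ε).obj 0, (stableQuotient ε).map_isZero (isZero_zero B)⟩

/-- The assertion that a given shift and a given class of distinguished triangles on the stable
category of `(B, ε)` are Happel's. The shift `X⟦1⟧` is the cokernel `Y` of an inflation of `X`
into an injective object `I`: every conflation `X ⟶ I ⟶ Y` with `I` injective comes with an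
isomorphism `Y ≅ X⟦1⟧` in the stable category, naturally in the conflation. The distinguished
triangles are those isomorphic to a standard triangle `X ⟶ M ⟶ Z ⟶ X⟦1⟧`, which is obtained from
a morphism `u : X ⟶ M` and such a conflation `X ⟶ I ⟶ Y` as
```
  X ⟶ I ⟶ Y
 u|    |b   ‖
  M ⟶ Z ⟶ Y
    v   w
```
where the left square is a push-out. -/
structure HappelTriangulation (ε : ObjectProperty (ShortComplex B))
    [HasZeroObject B] [HasBinaryBiproducts B] [HasShift (StableCategory ε) ℤ]
    [∀ n : ℤ, (shiftFunctor (StableCategory ε) n).Additive]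
    [Pretriangulated (StableCategory ε)] where
  suspIso (S : ShortComplex B) (hS : ε S) (hI : IsRelInjective ε S.X₂) :
    (stableQuotient ε).obj S.X₃ ≅ ((stableQuotient ε).obj S.X₁)⟦(1 : ℤ)⟧
  suspIso_naturality (S S' : ShortComplex B) (hS : ε S) (hI : IsRelInjective ε S.X₂)
    (hS' : ε S') (hI' : IsRelInjective ε S'.X₂) (φ : S ⟶ S') :
    (stableQuotient ε).map φ.τ₃ ≫ (suspIso S' hS' hI').hom =
      (suspIso S hS hI).hom ≫ ((stableQuotient ε).map φ.τ₁)⟦(1 : ℤ)⟧'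
  distinguished_iff (T : Triangle (StableCategory ε)) :
    T ∈ distTriang (StableCategory ε) ↔
      ∃ (S : ShortComplex B) (hS : ε S) (hI : IsRelInjective ε S.X₂) (M Z : B)
        (u : S.X₁ ⟶ M) (v : M ⟶ Z) (b : S.X₂ ⟶ Z) (w : Z ⟶ S.X₃),
        IsPushout S.f u b v ∧ b ≫ w = S.g ∧ v ≫ w = 0 ∧
        Nonempty (T ≅ Triangle.mk ((stableQuotient ε).map u) ((stableQuotient ε).map v)
          ((stableQuotient ε).map w ≫ (suspIso S hS hI).hom))

end Exact

/-- A functor between pretriangulated categories is a triangle equivalence if it is an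
equivalence of categories which, for a suitable commutation with the shifts, preserves
distinguished triangles. -/
def IsTriangleEquivalence {C D : Type*} [Category* C] [Category* D]
    [HasZeroObject C] [HasZeroObject D] [Preadditive C] [Preadditive D]
    [HasShift C ℤ] [HasShift D ℤ] [∀ n : ℤ, (shiftFunctor C n).Additive]
    [∀ n : ℤ, (shiftFunctor D n).Additive] [Pretriangulated C] [Pretriangulated D]
    (F : C ⥤ D) : Prop :=
  F.IsEquivalence ∧ ∃ _ : F.CommShift ℤ, F.IsTriangulated

/-! ### Verdier quotients -/

section Verdier

variable {T : Type u} [Category.{v} T] [HasZeroObject T] [HasShift T ℤ] [Preadditive T]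
  [∀ n : ℤ, (shiftFunctor T n).Additive] [Pretriangulated T] [IsTriangulated T]

/-- The Verdier quotient of the triangulated category `T` by the triangulated subcategory `P`:
the localization at the morphisms whose cone belongs to `P`. -/
def VerdierQuotient (P : ObjectProperty T) [P.IsTriangulated] : Type _ := P.trW.Localization

variable (P : ObjectProperty T) [P.IsTriangulated]

instance : Category (VerdierQuotient P) := inferInstanceAs (Category P.trW.Localization)

/-- The quotient functor. -/
def VerdierQuotient.Q : T ⥤ VerdierQuotient P := P.trW.Q

instance : (VerdierQuotient.Q P).IsLocalization P.trW :=
  inferInstanceAs (P.trW.Q.IsLocalization P.trW)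

instance : Preadditive (VerdierQuotient P) := inferInstanceAs (Preadditive P.trW.Localization)

instance : HasZeroObject (VerdierQuotient P) :=
  inferInstanceAs (HasZeroObject P.trW.Localization)

instance : HasShift (VerdierQuotient P) ℤ := inferInstanceAs (HasShift P.trW.Localization ℤ)

instance (n : ℤ) : (shiftFunctor (VerdierQuotient P) n).Additive :=
  inferInstanceAs (shiftFunctor P.trW.Localization n).Additive

instance : Pretriangulated (VerdierQuotient P) :=
  inferInstanceAs (Pretriangulated P.trW.Localization)

instance : IsTriangulated (VerdierQuotient P) :=
  inferInstanceAs (IsTriangulated P.trW.Localization)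

instance : (VerdierQuotient.Q P).CommShift ℤ := inferInstanceAs (P.trW.Q.CommShift ℤ)

instance : (VerdierQuotient.Q P).Additive := inferInstanceAs P.trW.Q.Additive

instance : (VerdierQuotient.Q P).IsTriangulated := inferInstanceAs P.trW.Q.IsTriangulated

end Verdier

section Abelian

variable {𝒜 : Type u} [Category.{v} 𝒜] [Abelian 𝒜]

/-! ### Approximations, relative acyclicity and relative dimension -/

/-- `f : C ⟶ M` is a right `𝒞`-approximation of `M`. -/
def IsRightApproximation (𝒞 : ObjectProperty 𝒜) {C M : 𝒜} (f : C ⟶ M) : Prop :=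
  𝒞 C ∧ ∀ ⦃C' : 𝒜⦄ (_ : 𝒞 C') (g : C' ⟶ M), ∃ h : C' ⟶ C, h ≫ f = g

/-- Every object has a right `𝒞`-approximation. -/
def IsContravariantlyFinite (𝒞 : ObjectProperty 𝒜) : Prop :=
  ∀ M : 𝒜, ∃ (C : 𝒜) (f : C ⟶ M), IsRightApproximation 𝒞 f

/-- Every right `𝒞`-approximation is an epimorphism. -/
def IsAdmissible (𝒞 : ObjectProperty 𝒜) : Prop :=
  ∀ ⦃C M : 𝒜⦄ (f : C ⟶ M), IsRightApproximation 𝒞 f → Epi f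

/-- `K` is `Hom(𝒞, -)`-exact, that is, `𝒞`-acyclic. -/
def IsHomFromExact (𝒞 : ObjectProperty 𝒜) (K : CochainComplex 𝒜 ℤ) : Prop :=
  ∀ C : 𝒜, 𝒞 C →
    (((preadditiveCoyoneda.obj (op C)).mapHomologicalComplex (ComplexShape.up ℤ)).obj K).Acyclic

/-- `K` is `Hom(-, 𝒞)`-exact. -/
def IsHomToExact (𝒞 : ObjectProperty 𝒜) (K : CochainComplex 𝒜 ℤ) : Prop :=
  ∀ C : 𝒜, 𝒞 C →
    (((preadditiveYoneda.obj C).mapHomologicalComplex (ComplexShape.up ℤ).symm).obj K.op).Acyclic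

/-- There is a `Hom(𝒞, -)`-exact complex `0 ⟶ D⁻ⁿ ⟶ ⋯ ⟶ D⁰ ⟶ M ⟶ 0` with all `Dⁱ` in `𝒟`.
The object `M` is put in degree `1`. -/
def HasProperResolutionOfLength (𝒞 𝒟 : ObjectProperty 𝒜) (M : 𝒜) (n : ℕ) : Prop :=
  ∃ K : CochainComplex 𝒜 ℤ, IsHomFromExact 𝒞 K ∧ Nonempty (K.X 1 ≅ M) ∧
    (∀ i : ℤ, -(n : ℤ) ≤ i → i ≤ 0 → 𝒟 (K.X i)) ∧
    (∀ i : ℤ, i < -(n : ℤ) ∨ 1 < i → IsZero (K.X i))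

/-- The `𝒞`-proper `𝒟`-dimension of the object `M`. -/
def properDim (𝒞 𝒟 : ObjectProperty 𝒜) (M : 𝒜) : ℕ∞ :=
  ⨅ (n : ℕ) (_ : HasProperResolutionOfLength 𝒞 𝒟 M n), (n : ℕ∞)

/-- The `𝒞`-proper `𝒟`-dimension of the whole category. -/
def properGlobalDim (𝒞 𝒟 : ObjectProperty 𝒜) : ℕ∞ :=
  ⨆ M : 𝒜, properDim 𝒞 𝒟 M

/-! ### The Gorenstein category of `𝒞` -/

/-- The Gorenstein category `𝒢(𝒞)`. -/
def gorenstein (𝒞 : ObjectProperty 𝒜) : ObjectProperty 𝒜 := fun M =>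
  ∃ K : CochainComplex 𝒜 ℤ, (∀ i, 𝒞 (K.X i)) ∧ K.Acyclic ∧ IsHomFromExact 𝒞 K ∧
    IsHomToExact 𝒞 K ∧ Nonempty (M ≅ image (K.d (-1) 0))

/-- The class `ε` of all `Hom(𝒞, -)`-exact complexes `0 ⟶ L ⟶ M ⟶ N ⟶ 0` with terms
in `𝒢(𝒞)`. -/
def gorensteinConflations (𝒞 : ObjectProperty 𝒜) :
    ObjectProperty (ShortComplex (gorenstein 𝒞).FullSubcategory) := fun S =>
  ∀ C : 𝒜, 𝒞 C → ((S.map (gorenstein 𝒞).ι).map (preadditiveCoyoneda.obj (op C))).ShortExact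

lemma isHomFromExact_iff (𝒞 : ObjectProperty 𝒜) (K : CochainComplex 𝒜 ℤ) :
    IsHomFromExact 𝒞 K ↔ ∀ (C : 𝒜) (_ : 𝒞 C) (i j k : ℤ) (_ : i + 1 = j) (_ : j + 1 = k)
      (f : C ⟶ K.X j), f ≫ K.d j k = 0 → ∃ g : C ⟶ K.X i, g ≫ K.d i j = f := by
  refine forall_congr' fun C => forall_congr' fun hC => ?_
  rw [HomologicalComplex.acyclic_iff]
  constructor
  · intro h i j k hij hjk
    exact (ShortComplex.ab_exact_iff _).1
      ((HomologicalComplex.exactAt_iff' _ i j k (by simp; lia) (by simp; lia)).1 (h j))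
  · intro h j
    rw [HomologicalComplex.exactAt_iff' _ (j - 1) j (j + 1) (by simp) (by simp),
      ShortComplex.ab_exact_iff]
    exact h (j - 1) j (j + 1) (by lia) (by lia)

lemma isHomToExact_iff (𝒞 : ObjectProperty 𝒜) (K : CochainComplex 𝒜 ℤ) :
    IsHomToExact 𝒞 K ↔ ∀ (C : 𝒜) (_ : 𝒞 C) (i j k : ℤ) (_ : i + 1 = j) (_ : j + 1 = k)
      (f : K.X j ⟶ C), K.d i j ≫ f = 0 → ∃ g : K.X k ⟶ C, K.d j k ≫ g = f := by
  refine forall_congr' fun C => forall_congr' fun hC => ?_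
  rw [HomologicalComplex.acyclic_iff]
  constructor
  · intro h i j k hij hjk
    exact (ShortComplex.ab_exact_iff _).1
      ((HomologicalComplex.exactAt_iff' _ k j i (ComplexShape.prev_eq' _ hjk)
        (ComplexShape.next_eq' _ hij)).1 (h j))
  · intro h j
    rw [HomologicalComplex.exactAt_iff' _ (j + 1) j (j - 1)
      (ComplexShape.prev_eq' _ (show j + 1 = j + 1 from rfl))
      (ComplexShape.next_eq' _ (show j - 1 + 1 = j by lia)),
      ShortComplex.ab_exact_iff]
    exact h (j - 1) j (j + 1) (by lia) (by lia)

lemma acyclic_biprod {K L : CochainComplex 𝒜 ℤ} (hK : K.Acyclic) (hL : L.Acyclic) :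
    (K ⊞ L).Acyclic := by
  intro i
  rw [HomologicalComplex.exactAt_iff_isZero_homology]
  have := preservesBinaryBiproducts_of_preservesBiproducts
    (HomologicalComplex.homologyFunctor 𝒜 (ComplexShape.up ℤ) i)
  refine IsZero.of_iso ?_
    ((HomologicalComplex.homologyFunctor 𝒜 (ComplexShape.up ℤ) i).mapBiprod K L)
  rw [biprod_isZero_iff]
  exact ⟨(HomologicalComplex.exactAt_iff_isZero_homology _ _).1 (hK i),
    (HomologicalComplex.exactAt_iff_isZero_homology _ _).1 (hL i)⟩

lemma isHomFromExact_biprod {𝒞 : ObjectProperty 𝒜} {K L : CochainComplex 𝒜 ℤ}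
    (hK : IsHomFromExact 𝒞 K) (hL : IsHomFromExact 𝒞 L) : IsHomFromExact 𝒞 (K ⊞ L) := by
  rw [isHomFromExact_iff] at hK hL ⊢
  intro C hC i j k hij hjk f hf
  obtain ⟨g₁, h₁⟩ := hK C hC i j k hij hjk (f ≫ (biprod.fst : K ⊞ L ⟶ K).f j)
    (by rw [Category.assoc, HomologicalComplex.Hom.comm, reassoc_of% hf, zero_comp])
  obtain ⟨g₂, h₂⟩ := hL C hC i j k hij hjk (f ≫ (biprod.snd : K ⊞ L ⟶ L).f j)
    (by rw [Category.assoc, HomologicalComplex.Hom.comm, reassoc_of% hf, zero_comp])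
  refine ⟨g₁ ≫ (biprod.inl : K ⟶ K ⊞ L).f i + g₂ ≫ (biprod.inr : L ⟶ K ⊞ L).f i, ?_⟩
  rw [Preadditive.add_comp, Category.assoc, Category.assoc, HomologicalComplex.Hom.comm,
    HomologicalComplex.Hom.comm, reassoc_of% h₁, reassoc_of% h₂, ← Preadditive.comp_add,
    ← HomologicalComplex.comp_f, ← HomologicalComplex.comp_f, ← HomologicalComplex.add_f_apply,
    biprod.total, HomologicalComplex.id_f, Category.comp_id]

lemma isHomToExact_biprod {𝒞 : ObjectProperty 𝒜} {K L : CochainComplex 𝒜 ℤ}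
    (hK : IsHomToExact 𝒞 K) (hL : IsHomToExact 𝒞 L) : IsHomToExact 𝒞 (K ⊞ L) := by
  rw [isHomToExact_iff] at hK hL ⊢
  intro C hC i j k hij hjk f hf
  obtain ⟨g₁, h₁⟩ := hK C hC i j k hij hjk ((biprod.inl : K ⟶ K ⊞ L).f j ≫ f)
    (by rw [← HomologicalComplex.Hom.comm_assoc, hf, comp_zero])
  obtain ⟨g₂, h₂⟩ := hL C hC i j k hij hjk ((biprod.inr : L ⟶ K ⊞ L).f j ≫ f)
    (by rw [← HomologicalComplex.Hom.comm_assoc, hf, comp_zero])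
  refine ⟨(biprod.fst : K ⊞ L ⟶ K).f k ≫ g₁ + (biprod.snd : K ⊞ L ⟶ L).f k ≫ g₂, ?_⟩
  rw [Preadditive.comp_add, ← HomologicalComplex.Hom.comm_assoc,
    ← HomologicalComplex.Hom.comm_assoc, h₁, h₂, ← Category.assoc, ← Category.assoc,
    ← Preadditive.add_comp,
    ← HomologicalComplex.comp_f, ← HomologicalComplex.comp_f, ← HomologicalComplex.add_f_apply,
    biprod.total, HomologicalComplex.id_f, Category.id_comp]

instance (𝒞 : ObjectProperty 𝒜) : (gorenstein 𝒞).IsClosedUnderIsomorphisms where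
  of_iso := by
    rintro X Y e ⟨K, h₁, h₂, h₃, h₄, ⟨e'⟩⟩
    exact ⟨K, h₁, h₂, h₃, h₄, ⟨e.symm ≪≫ e'⟩⟩

lemma prop_biprod (P : ObjectProperty 𝒜) [P.IsClosedUnderBinaryProducts] {X Y : 𝒜}
    (hX : P X) (hY : P Y) : P (X ⊞ Y) :=
  P.prop_of_isLimit_binaryFan (BinaryBiproduct.isLimit X Y) hX hY

instance (𝒞 : ObjectProperty 𝒜) [𝒞.ContainsZero] [𝒞.IsClosedUnderIsomorphisms] :
    (gorenstein 𝒞).ContainsZero where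
  exists_zero := by
    have hz : IsZero (0 : CochainComplex 𝒜 ℤ) := isZero_zero _
    have hX (i : ℤ) : IsZero ((0 : CochainComplex 𝒜 ℤ).X i) :=
      (HomologicalComplex.eval 𝒜 (ComplexShape.up ℤ) i).map_isZero hz
    refine ⟨0, isZero_zero 𝒜, 0, fun i => 𝒞.prop_of_isZero (hX i), ?_, ?_, ?_, ⟨?_⟩⟩
    · intro i
      rw [HomologicalComplex.exactAt_iff_isZero_homology]
      exact (HomologicalComplex.homologyFunctor 𝒜 (ComplexShape.up ℤ) i).map_isZero hz
    · rw [isHomFromExact_iff]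
      intro C _ i j k _ _ f _
      exact ⟨0, (hX j).eq_of_tgt _ _⟩
    · rw [isHomToExact_iff]
      intro C _ i j k _ _ f _
      exact ⟨0, (hX j).eq_of_src _ _⟩
    · exact (isZero_zero 𝒜).iso (IsZero.of_mono (image.ι _) (hX 0))

lemma gorenstein_biprod (𝒞 : ObjectProperty 𝒜) [𝒞.IsClosedUnderIsomorphisms]
    [𝒞.IsClosedUnderBinaryProducts] {X Y : 𝒜} (hX : gorenstein 𝒞 X) (hY : gorenstein 𝒞 Y) :
    gorenstein 𝒞 (X ⊞ Y) := by
  obtain ⟨K, h₁, h₂, h₃, h₄, ⟨e⟩⟩ := hX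
  obtain ⟨L, h₁', h₂', h₃', h₄', ⟨e'⟩⟩ := hY
  refine ⟨K ⊞ L, fun i => 𝒞.prop_of_iso (HomologicalComplex.biprodXIso K L i).symm
    (prop_biprod 𝒞 (h₁ i) (h₁' i)), acyclic_biprod h₂ h₂', isHomFromExact_biprod h₃ h₃',
    isHomToExact_biprod h₄ h₄', ⟨biprod.mapIso e e' ≪≫ ?_⟩⟩
  have (f : K.X (-1) ⟶ image (K.d (-1) 0)) (g : L.X (-1) ⟶ image (L.d (-1) 0))
      [Epi f] [Epi g] : StrongEpi ((HomologicalComplex.biprodXIso K L (-1)).hom ≫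
        biprod.map f g) := by
    have : Epi (biprod.map f g) := inferInstance
    exact strongEpi_of_epi _
  refine image.isoStrongEpiMono ((HomologicalComplex.biprodXIso K L (-1)).hom ≫
      biprod.map (factorThruImage _) (factorThruImage _))
    (biprod.map (image.ι _) (image.ι _) ≫ (HomologicalComplex.biprodXIso K L 0).inv) ?_
  rw [← cancel_epi (HomologicalComplex.biprodXIso K L (-1)).inv]
  ext <;> simp

instance (𝒞 : ObjectProperty 𝒜) [𝒞.IsClosedUnderIsomorphisms]
    [𝒞.IsClosedUnderBinaryProducts] : (gorenstein 𝒞).IsClosedUnderBinaryProducts where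
  limitsOfShape_le := by
    rintro X ⟨p⟩
    let e : X ≅ p.diag.obj ⟨WalkingPair.left⟩ ⊞ p.diag.obj ⟨WalkingPair.right⟩ :=
      p.isLimit.conePointsIsoOfNatIso (BinaryBiproduct.isLimit _ _) (diagramIsoPair p.diag)
    exact (gorenstein 𝒞).prop_of_iso e.symm
      (gorenstein_biprod 𝒞 (p.prop_diag_obj _) (p.prop_diag_obj _))

instance (𝒞 : ObjectProperty 𝒜) [𝒞.IsClosedUnderIsomorphisms]
    [𝒞.IsClosedUnderBinaryProducts] : HasBinaryBiproducts (gorenstein 𝒞).FullSubcategory :=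
  HasBinaryBiproducts.of_hasBinaryProducts

/-! ### Bounded homotopy categories and relative derived categories -/

/-- The bounded complexes with terms in `P`, as objects of the homotopy category. -/
def boundedIn (P : ObjectProperty 𝒜) : ObjectProperty (HomotopyCategory 𝒜 (ComplexShape.up ℤ)) :=
  fun X => (∃ a b : ℤ, ∀ i : ℤ, i < a ∨ b < i → IsZero (X.as.X i)) ∧ ∀ i : ℤ, P (X.as.X i)

instance (P : ObjectProperty 𝒜) [P.ContainsZero] [P.IsClosedUnderIsomorphisms] :
    (boundedIn P).ContainsZero where
  exists_zero := by
    have hX (i : ℤ) : IsZero ((0 : CochainComplex 𝒜 ℤ).X i) :=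
      (HomologicalComplex.eval 𝒜 (ComplexShape.up ℤ) i).map_isZero (isZero_zero _)
    exact ⟨(HomotopyCategory.quotient _ _).obj 0, Functor.map_isZero _ (isZero_zero _),
      ⟨0, 0, fun i _ => hX i⟩, fun i => P.prop_of_isZero (hX i)⟩

instance (P : ObjectProperty 𝒜) : (boundedIn P).IsStableUnderShift ℤ where
  isStableUnderShiftBy n :=
    { le_shift := by
        intro X hX
        obtain ⟨K, rfl⟩ := X.quotient_obj_surjective
        obtain ⟨⟨a, b, h⟩, h'⟩ := hX
        rw [ObjectProperty.prop_shift_iff, HomotopyCategory.shift_quotient_obj]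
        exact ⟨⟨a - n, b - n, fun i hi => h (i + n) (by lia)⟩, fun i => h' (i + n)⟩ }

instance (P : ObjectProperty 𝒜) [P.ContainsZero] [P.IsClosedUnderIsomorphisms]
    [P.IsClosedUnderBinaryProducts] : (boundedIn P).IsTriangulatedClosed₃ where
  ext₃' T hT h₁ h₂ := by
    obtain ⟨⟨a₁, b₁, h₁⟩, h₁'⟩ := h₁
    obtain ⟨⟨a₂, b₂, h₂⟩, h₂'⟩ := h₂
    obtain ⟨f : T.obj₁.as ⟶ T.obj₂.as, hf⟩ :=
      (HomotopyCategory.quotient _ _).map_surjective T.mor₁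
    refine ⟨(HomotopyCategory.quotient _ _).obj (CochainComplex.mappingCone f), ⟨⟨min (a₁ - 1) a₂,
      max b₁ b₂, fun i hi => ?_⟩, fun i => ?_⟩,
      ⟨Triangle.π₃.mapIso (isoTriangleOfIso₁₂ T _ hT
        (HomotopyCategory.mappingCone_triangleh_distinguished f)
        (Iso.refl _) (Iso.refl _) ?_)⟩⟩
    · exact (CochainComplex.mappingCone.isZero_X_iff f i).2
        ⟨h₁ _ (by lia), h₂ _ (by lia)⟩
    · exact P.prop_of_iso (HomologicalComplex.homotopyCofiber.XIsoBiprod f i (i + 1) rfl).symm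
        (prop_biprod P (h₁' _) (h₂' _))
    · rw [← hf]
      exact (Category.comp_id _).trans (Category.id_comp _).symm

instance (P : ObjectProperty 𝒜) [P.ContainsZero] [P.IsClosedUnderIsomorphisms]
    [P.IsClosedUnderBinaryProducts] : (boundedIn P).IsTriangulated where
  toIsTriangulatedClosed₂ := .of_isTriangulatedClosed₃

instance : (⊤ : ObjectProperty 𝒜).IsClosedUnderBinaryProducts where
  limitsOfShape_le _ _ := trivial

variable (𝒜) in
/-- The bounded homotopy category `K^b(𝒜)`. -/
abbrev Kb : Type _ := (boundedIn (⊤ : ObjectProperty 𝒜)).FullSubcategory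

variable (𝒜) in
/-- The inclusion `K^b(𝒜) ⥤ K(𝒜)`. -/
abbrev Kb.ι : Kb 𝒜 ⥤ HomotopyCategory 𝒜 (ComplexShape.up ℤ) :=
  (boundedIn (⊤ : ObjectProperty 𝒜)).ι

variable (𝒜) in
/-- The functor `𝒜 ⥤ K^b(𝒜)` sending an object to the complex concentrated in degree `0`. -/
def Kb.single : 𝒜 ⥤ Kb 𝒜 :=
  (boundedIn (⊤ : ObjectProperty 𝒜)).lift (HomotopyCategory.singleFunctor 𝒜 0)
    (fun X => ⟨⟨0, 0, fun i hi => HomologicalComplex.isZero_single_obj_X (ComplexShape.up ℤ) 0 X i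
      (by lia)⟩, fun _ => trivial⟩)

/-- The `𝒞`-acyclic complexes, as objects of the homotopy category. -/
def acyclicIn (𝒞 : ObjectProperty 𝒜) :
    ObjectProperty (HomotopyCategory 𝒜 (ComplexShape.up ℤ)) :=
  fun X => IsHomFromExact 𝒞 X.as

lemma acyclicIn_eq (𝒞 : ObjectProperty 𝒜) : acyclicIn 𝒞 = fun X => ∀ C, 𝒞 C →
    (HomotopyCategory.subcategoryAcyclic AddCommGrpCat.{v}).inverseImage
      ((preadditiveCoyoneda.obj (op C)).mapHomotopyCategory (ComplexShape.up ℤ)) X := by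
  ext X
  obtain ⟨K, rfl⟩ := X.quotient_obj_surjective
  exact forall_congr' fun C => forall_congr' fun _ =>
    (HomotopyCategory.quotient_obj_mem_subcategoryAcyclic_iff_acyclic _).symm

instance (𝒞 : ObjectProperty 𝒜) : (acyclicIn 𝒞).IsClosedUnderIsomorphisms := by
  rw [acyclicIn_eq]
  exact ⟨fun e h C hC => ObjectProperty.prop_of_iso _ e (h C hC)⟩

instance (𝒞 : ObjectProperty 𝒜) : (acyclicIn 𝒞).IsTriangulated := by
  have h : (acyclicIn 𝒞).IsClosedUnderIsomorphisms := inferInstance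
  rw [acyclicIn_eq] at h ⊢
  exact
    { exists_zero := ⟨0, isZero_zero _, fun C _ => ObjectProperty.prop_zero _⟩
      isStableUnderShiftBy := fun n => ⟨fun X hX C hC => ObjectProperty.le_shift _ n _ (hX C hC)⟩
      toIsTriangulatedClosed₂ := .mk' fun T hT h₁ h₃ C hC =>
        ObjectProperty.ext_of_isTriangulatedClosed₂ _ T hT (h₁ C hC) (h₃ C hC) }

/-- The `𝒞`-acyclic complexes in `K^b(𝒜)`. -/
abbrev Kb.acyclic (𝒞 : ObjectProperty 𝒜) : ObjectProperty (Kb 𝒜) :=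
  (acyclicIn 𝒞).inverseImage (Kb.ι 𝒜)

/-- The bounded `𝒞`-derived category, the Verdier quotient of `K^b(𝒜)` by the
`𝒞`-acyclic complexes. -/
abbrev Db (𝒞 : ObjectProperty 𝒜) : Type _ := VerdierQuotient (Kb.acyclic 𝒞)

/-- The quotient functor `K^b(𝒜) ⥤ D^b_𝒞(𝒜)`. -/
abbrev Db.Q (𝒞 : ObjectProperty 𝒜) : Kb 𝒜 ⥤ Db 𝒞 := VerdierQuotient.Q (Kb.acyclic 𝒞)

/-- The strictly full subcategory `K^b(𝒞)` of `K^b(𝒜)`. -/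
abbrev Kb.sub (𝒞 : ObjectProperty 𝒜) : ObjectProperty (Kb 𝒜) :=
  (boundedIn 𝒞).isoClosure.inverseImage (Kb.ι 𝒜)

/-- Maps from bounded complexes in `𝒞` to `𝒞`-acyclic complexes are null-homotopic. -/
lemma nonempty_homotopy_zero {𝒞 : ObjectProperty 𝒜} {K L : CochainComplex 𝒜 ℤ}
    (hK : ∀ i, 𝒞 (K.X i)) {a b : ℤ} (hab : ∀ i : ℤ, i < a ∨ b < i → IsZero (K.X i))
    (hL : IsHomFromExact 𝒞 L) (f : K ⟶ L) : Nonempty (Homotopy f 0) := by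
  rw [isHomFromExact_iff] at hL
  have key (m : ℕ) : ∃ h : ∀ i j : ℤ, K.X i ⟶ L.X j, ∀ i : ℤ, b - m < i →
      f.f i = K.d i (i + 1) ≫ h (i + 1) i + h i (i - 1) ≫ L.d (i - 1) i := by
    induction m with
    | zero => exact ⟨0, fun i hi => (hab i (Or.inr (by simpa using hi))).eq_of_src _ _⟩
    | succ m ih =>
      obtain ⟨h, hh⟩ := ih
      obtain ⟨n, hn⟩ : ∃ n : ℤ, n = b - m := ⟨_, rfl⟩
      obtain ⟨ψ, hψ⟩ := hL (K.X n) (hK n) (n - 1) n (n + 1) (by lia) rfl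
        (f.f n - K.d n (n + 1) ≫ h (n + 1) n) (by
          have h₁ := hh (n + 1) (by lia)
          have h₂ : h (n + 1) (n + 1 - 1) ≫ L.d (n + 1 - 1) (n + 1) =
            h (n + 1) n ≫ L.d n (n + 1) := by
            rw [show n + 1 - 1 = n by lia]
          rw [h₂] at h₁
          rw [Preadditive.sub_comp, Category.assoc, HomologicalComplex.Hom.comm, h₁,
            Preadditive.comp_add, K.d_comp_d_assoc, zero_comp, zero_add, sub_self])
      refine ⟨Function.update h n (Function.update (h n) (n - 1) ψ), fun i hi => ?_⟩
      obtain rfl | hi' := eq_or_ne i n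
      · rw [Function.update_of_ne (by lia), Function.update_self, Function.update_self, hψ]
        abel
      · rw [Function.update_of_ne (by lia), Function.update_of_ne (by lia)]
        exact hh i (by push_cast at hi; lia)
  obtain ⟨h, hh⟩ := key (b - a + 1).toNat
  have hh' (i : ℤ) : f.f i = K.d i (i + 1) ≫ h (i + 1) i + h i (i - 1) ≫ L.d (i - 1) i := by
    by_cases hi : i < a
    · exact (hab i (Or.inl hi)).eq_of_src _ _
    · exact hh i (by lia)
  refine ⟨{ hom := fun i j => if j + 1 = i then h i j else 0, zero := ?_, comm := ?_ }⟩
  · intro i j hij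
    exact if_neg hij
  · intro i
    rw [dNext_eq _ (show (ComplexShape.up ℤ).Rel i (i + 1) from rfl),
      prevD_eq _ (show (ComplexShape.up ℤ).Rel (i - 1) i by simp), if_pos rfl,
      if_pos (by lia), HomologicalComplex.zero_f, add_zero, hh' i]

lemma Kb.sub_le_leftOrthogonal (𝒞 : ObjectProperty 𝒜) :
    Kb.sub 𝒞 ≤ (Kb.acyclic 𝒞).leftOrthogonal := by
  rintro X ⟨Y, ⟨⟨a, b, hab⟩, hY⟩, ⟨e⟩⟩ Z f hZ
  obtain ⟨g, hg⟩ := (HomotopyCategory.quotient _ _).map_surjective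
    (X := Y.as) (Y := Z.obj.as) (e.inv ≫ (Kb.ι 𝒜).map f)
  obtain ⟨h⟩ := nonempty_homotopy_zero hY hab hZ g
  have h0 := HomotopyCategory.eq_of_homotopy _ _ h
  rw [hg, Functor.map_zero] at h0
  apply (Kb.ι 𝒜).map_injective
  rw [Functor.map_zero, ← cancel_epi e.inv, comp_zero]
  exact h0

instance (𝒞 : ObjectProperty 𝒜) : ((Kb.sub 𝒞).ι ⋙ Db.Q 𝒞).Full where
  map_surjective {X Y} f := by
    obtain ⟨g, hg⟩ := (((Kb.sub_le_leftOrthogonal 𝒞) _ X.property).map_bijective_of_isTriangulated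
      (Db.Q 𝒞) Y.obj).2 f
    exact ⟨ObjectProperty.homMk g, hg⟩

/-- `K^b(𝒞)` viewed as a strictly full triangulated subcategory of `D^b_𝒞(𝒜)`. -/
abbrev Db.sub (𝒞 : ObjectProperty 𝒜) [𝒞.ContainsZero] [𝒞.IsClosedUnderIsomorphisms]
    [𝒞.IsClosedUnderBinaryProducts] : ObjectProperty (Db 𝒞) :=
  ((Kb.sub 𝒞).ι ⋙ Db.Q 𝒞).essImage

instance (𝒞 : ObjectProperty 𝒜) [𝒞.ContainsZero] [𝒞.IsClosedUnderIsomorphisms]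
    [𝒞.IsClosedUnderBinaryProducts] : (Db.sub 𝒞).IsTriangulated := by
  have : ((Kb.sub 𝒞).ι ⋙ Db.Q 𝒞).Full := inferInstance
  have : ((Kb.sub 𝒞).ι ⋙ Db.Q 𝒞).IsTriangulated := inferInstance
  exact ObjectProperty.instIsTriangulatedEssImageOfIsTriangulatedOfFull ((Kb.sub 𝒞).ι ⋙ Db.Q 𝒞)

/-- The `𝒞`-singularity category, the Verdier quotient `D^b_𝒞(𝒜) / K^b(𝒞)`. -/
abbrev Dsg (𝒞 : ObjectProperty 𝒜) [𝒞.ContainsZero] [𝒞.IsClosedUnderIsomorphisms]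
    [𝒞.IsClosedUnderBinaryProducts] : Type _ := VerdierQuotient (Db.sub 𝒞)

/-- The quotient functor `D^b_𝒞(𝒜) ⥤ D_{𝒞-sg}(𝒜)`. -/
abbrev Dsg.Q (𝒞 : ObjectProperty 𝒜) [𝒞.ContainsZero] [𝒞.IsClosedUnderIsomorphisms]
    [𝒞.IsClosedUnderBinaryProducts] : Db 𝒞 ⥤ Dsg 𝒞 := VerdierQuotient.Q (Db.sub 𝒞)

/-- The natural functor `θ : 𝒢(𝒞) ⥤ D_{𝒞-sg}(𝒜)`. -/
def theta (𝒞 : ObjectProperty 𝒜) [𝒞.ContainsZero] [𝒞.IsClosedUnderIsomorphisms]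
    [𝒞.IsClosedUnderBinaryProducts] : (gorenstein 𝒞).FullSubcategory ⥤ Dsg 𝒞 :=
  (gorenstein 𝒞).ι ⋙ Kb.single 𝒜 ⋙ Db.Q 𝒞 ⋙ Dsg.Q 𝒞

end Abelian

end RelSing

end

open RelSing

/-!
The images of the differentials of totally `𝒞`-acyclic complexes are characterized coinductively:
`𝒢(𝒞)` is the largest class of objects all of which have a syzygy and a cosyzygy in the class, via
short exact sequences with middle term in `𝒞` which are exact under both `Hom(𝒞, -)` and
`Hom(-, 𝒞)`. Closure of `𝒢(𝒞)` under proper extensions then follows from a horseshoe construction,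
and it makes `𝒢(𝒞)` a Frobenius category whose projectives are the retracts of objects of `𝒞`.

A proper short exact sequence gives a triangle in `D^b_𝒞(𝒜)`, where negative extensions between
modules vanish and `𝒜` is fully faithful. If `M` is in `𝒢(𝒞)`, so are its syzygies, and
dimension shifting shows that a morphism from `M` to `P[m]` vanishes for `m > 0` and `P` in `𝒞`.
Hence roofs out of `M` in the quotient by `K^b(𝒞)` can be straightened to morphisms of modules: `θ`
is full, and it identifies exactly those morphisms whose difference factors through `𝒞`.

The essential image of `θ` is a triangulated subcategory, since (co)syzygies compute the shifts and
push-outs along cosyzygies compute the cones. Finite dimension resolves each module by objects of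
`𝒢(𝒞)`, so `θ` is essentially surjective. Finally, the triangulation of `D_{𝒞-sg}(𝒜)` is transported
along the equivalence, and its triangles are Happel's because proper conflations give triangles.
-/

noncomputable section

namespace RelSing

variable {𝒜 : Type u} [Category.{v} 𝒜] {𝒞 : ObjectProperty 𝒜}

/-- Every object has an epimorphic right `𝒞`-approximation, which is what contravariant finiteness
and admissibility of `𝒞` provide. -/
class HasEpiApproximations (𝒞 : ObjectProperty 𝒜) : Prop where
  exists_epi (M : 𝒜) : ∃ (C : 𝒜) (f : C ⟶ M), IsRightApproximation 𝒞 f ∧ Epi f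

lemma IsContravariantlyFinite.hasEpiApproximations (hfin : IsContravariantlyFinite 𝒞)
    (hadm : IsAdmissible 𝒞) : HasEpiApproximations 𝒞 where
  exists_epi M :=
    let ⟨C, f, hf⟩ := hfin M
    ⟨C, f, hf, hadm f hf⟩

lemma exists_epi_of_hasEpiApproximations (𝒞 : ObjectProperty 𝒜) [HasEpiApproximations 𝒞] (M : 𝒜) :
    ∃ (C : 𝒜) (f : C ⟶ M), 𝒞 C ∧ Epi f :=
  let ⟨C, f, hf, hf'⟩ := HasEpiApproximations.exists_epi (𝒞 := 𝒞) M
  ⟨C, f, hf.1, hf'⟩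

variable [Abelian 𝒜]

/-! ### Proper short exact sequences -/

section Proper

/-- A short exact sequence is `𝒞`-proper if it is `Hom(𝒞, -)`-exact, that is, if maps from objects
of `𝒞` lift along its epimorphism. -/
structure IsProper (𝒞 : ObjectProperty 𝒜) (S : ShortComplex 𝒜) : Prop where
  shortExact : S.ShortExact
  lift ⦃C : 𝒜⦄ (hC : 𝒞 C) (f : C ⟶ S.X₃) : ∃ g : C ⟶ S.X₂, g ≫ S.g = f

/-- A short complex is `𝒞`-coproper if maps to objects of `𝒞` extend along its first map; for a
short exact sequence this is `Hom(-, 𝒞)`-exactness. -/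
def IsCoproper (𝒞 : ObjectProperty 𝒜) (S : ShortComplex 𝒜) : Prop :=
  ∀ ⦃C : 𝒜⦄ (_ : 𝒞 C) (f : S.X₁ ⟶ C), ∃ g : S.X₂ ⟶ C, S.f ≫ g = f

variable {S T : ShortComplex 𝒜}

lemma exact_of_exists_desc [Epi S.g]
    (h : ∀ ⦃T : 𝒜⦄ (f : S.X₂ ⟶ T), S.f ≫ f = 0 → ∃ g : S.X₃ ⟶ T, S.g ≫ g = f) : S.Exact :=
  S.exact_of_g_is_cokernel (CokernelCofork.IsColimit.ofπ _ _ (fun f hf => (h f hf).choose)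
    (fun f hf => (h f hf).choose_spec)
    (fun f hf m hm => by rw [← cancel_epi S.g, hm, (h f hf).choose_spec]))

lemma exact_of_exists_lift [Mono S.f]
    (h : ∀ ⦃T : 𝒜⦄ (f : T ⟶ S.X₂), f ≫ S.g = 0 → ∃ g : T ⟶ S.X₁, g ≫ S.f = f) : S.Exact :=
  S.exact_of_f_is_kernel (KernelFork.IsLimit.ofι _ _ (fun f hf => (h f hf).choose)
    (fun f hf => (h f hf).choose_spec)
    (fun f hf m hm => by rw [← cancel_mono S.f, hm, (h f hf).choose_spec]))

namespace IsProper

lemma of_iso (e : S ≅ T) (hS : IsProper 𝒞 S) : IsProper 𝒞 T where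
  shortExact := ShortComplex.shortExact_of_iso e hS.shortExact
  lift C hC f := by
    obtain ⟨g, hg⟩ := hS.lift hC (f ≫ e.inv.τ₃)
    refine ⟨g ≫ e.hom.τ₂, ?_⟩
    rw [Category.assoc, e.hom.comm₂₃, reassoc_of% hg, ← ShortComplex.comp_τ₃, e.inv_hom_id,
      ShortComplex.id_τ₃, Category.comp_id]

lemma of_splitting (s : S.Splitting) : IsProper 𝒞 S where
  shortExact := s.shortExact
  lift C _ f := ⟨f ≫ s.s, by simp⟩

lemma of_isZero_X₁ {M N : 𝒜} (hN : IsZero N) :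
    IsProper 𝒞 (ShortComplex.mk (0 : N ⟶ M) (𝟙 M) zero_comp) :=
  of_splitting { r := 0, s := 𝟙 M, f_r := hN.eq_of_src _ _ }

lemma of_isZero_X₃ {M N : 𝒜} (hN : IsZero N) :
    IsProper 𝒞 (ShortComplex.mk (𝟙 M) (0 : M ⟶ N) comp_zero) :=
  of_splitting { r := 𝟙 M, s := 0, s_g := hN.eq_of_src _ _ }

lemma mono_f (hS : IsProper 𝒞 S) : Mono S.f := hS.shortExact.mono_f

lemma epi_g (hS : IsProper 𝒞 S) : Epi S.g := hS.shortExact.epi_g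

lemma exists_lift (hS : IsProper 𝒞 S) {T : 𝒜} (f : T ⟶ S.X₂) (hf : f ≫ S.g = 0) :
    ∃ g : T ⟶ S.X₁, g ≫ S.f = f :=
  have := hS.mono_f
  ⟨hS.shortExact.exact.lift f hf, hS.shortExact.exact.lift_f _ _⟩

lemma exists_desc (hS : IsProper 𝒞 S) {T : 𝒜} (f : S.X₂ ⟶ T) (hf : S.f ≫ f = 0) :
    ∃ g : S.X₃ ⟶ T, S.g ≫ g = f :=
  have := hS.epi_g
  ⟨hS.shortExact.exact.desc f hf, hS.shortExact.exact.g_desc _ _⟩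

lemma shortExact_map {S : ShortComplex 𝒜} (hS : IsProper 𝒞 S) {C : 𝒜} (hC : 𝒞 C) :
    (S.map (preadditiveCoyoneda.obj (op C))).ShortExact where
  exact := (ShortComplex.ab_exact_iff _).2 hS.exists_lift
  mono_f := (AddCommGrpCat.mono_iff_injective _).2 fun _ _ h =>
    have := hS.mono_f
    (cancel_mono S.f).1 h
  epi_g := (AddCommGrpCat.epi_iff_surjective _).2 (hS.lift hC)

lemma exists_section (hS : IsProper 𝒞 S) (h : 𝒞 S.X₃) : ∃ s : S.X₃ ⟶ S.X₂, s ≫ S.g = 𝟙 _ :=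
  hS.lift h (𝟙 _)

lemma pushout (hS : IsProper 𝒞 S) {X Y : 𝒜} {u : S.X₁ ⟶ X} {b : S.X₂ ⟶ Y} {v : X ⟶ Y}
    (sq : IsPushout S.f u b v) {w : Y ⟶ S.X₃} (hb : b ≫ w = S.g) (hv : v ≫ w = 0) :
    IsProper 𝒞 (ShortComplex.mk v w hv) := by
  have := hS.mono_f
  have := hS.epi_g
  have : Mono v := (MorphismProperty.monomorphisms 𝒜).of_isPushout sq.flip
    (MorphismProperty.monomorphisms.infer_property S.f)
  have : Epi w := epi_of_epi_fac hb
  refine ⟨.mk' (exact_of_exists_desc fun T (k : Y ⟶ T) (hk : v ≫ k = 0) => ?_) ‹_› ‹_›,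
    fun C hC f => ?_⟩
  · obtain ⟨l, hl⟩ := hS.exists_desc (b ≫ k) (by rw [sq.w_assoc, hk, comp_zero])
    exact ⟨l, sq.hom_ext (by rw [reassoc_of% hb, hl]) (by rw [reassoc_of% hv, hk, zero_comp])⟩
  · obtain ⟨g, hg⟩ := hS.lift hC f
    exact ⟨g ≫ b, by simp [hb, hg]⟩

lemma pullback (hS : IsProper 𝒞 S) {Y Z : 𝒜} {a : Y ⟶ S.X₂} {q : Y ⟶ Z} {z : Z ⟶ S.X₃}
    (sq : IsPullback a q S.g z) {j : S.X₁ ⟶ Y} (ha : j ≫ a = S.f) (hj : j ≫ q = 0) :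
    IsProper 𝒞 (ShortComplex.mk j q hj) := by
  have := hS.mono_f
  have := hS.epi_g
  have : Epi q := (MorphismProperty.epimorphisms 𝒜).of_isPullback sq
    (MorphismProperty.epimorphisms.infer_property S.g)
  have : Mono j := mono_of_mono_fac ha
  refine ⟨.mk' (exact_of_exists_lift fun T (k : T ⟶ Y) (hk : k ≫ q = 0) => ?_) ‹_› ‹_›,
    fun C hC f => ?_⟩
  · obtain ⟨l, hl⟩ := hS.exists_lift (k ≫ a) (by
      rw [Category.assoc, sq.w, reassoc_of% hk, zero_comp])
    exact ⟨l, sq.hom_ext (by rw [Category.assoc, ha, hl])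
      (by rw [Category.assoc, hj, hk, comp_zero])⟩
  · obtain ⟨g, hg⟩ := hS.lift hC (f ≫ z)
    exact ⟨sq.lift g f hg, sq.lift_snd _ _ _⟩

lemma exists_pushout (hS : IsProper 𝒞 S) {X : 𝒜} (u : S.X₁ ⟶ X) :
    ∃ (Y : 𝒜) (b : S.X₂ ⟶ Y) (v : X ⟶ Y) (w : Y ⟶ S.X₃) (hv : v ≫ w = 0),
      IsPushout S.f u b v ∧ b ≫ w = S.g ∧ IsProper 𝒞 (ShortComplex.mk v w hv) :=
  have sq := IsPushout.of_hasPushout S.f u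
  have h : S.f ≫ S.g = u ≫ 0 := by simp
  ⟨_, _, _, sq.desc S.g 0 h, sq.inr_desc _ _ _, sq, sq.inl_desc _ _ _,
    hS.pushout sq (sq.inl_desc _ _ _) (sq.inr_desc _ _ _)⟩

lemma exists_pullback (hS : IsProper 𝒞 S) {Z : 𝒜} (z : Z ⟶ S.X₃) :
    ∃ (Y : 𝒜) (a : Y ⟶ S.X₂) (q : Y ⟶ Z) (j : S.X₁ ⟶ Y) (hj : j ≫ q = 0),
      IsPullback a q S.g z ∧ j ≫ a = S.f ∧ IsProper 𝒞 (ShortComplex.mk j q hj) :=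
  have sq := IsPullback.of_hasPullback S.g z
  have h : S.f ≫ S.g = 0 ≫ z := by simp
  ⟨_, _, _, sq.lift S.f 0 h, sq.lift_snd _ _ _, sq, sq.lift_fst _ _ _,
    hS.pullback sq (sq.lift_fst _ _ _) (sq.lift_snd _ _ _)⟩

lemma comp_mono (hS : IsProper 𝒞 S) {Z B : 𝒜} {j : S.X₂ ⟶ Z} {q : Z ⟶ B} {hjq : j ≫ q = 0}
    (hT : IsProper 𝒞 (ShortComplex.mk j q hjq)) :
    ∃ (W : 𝒜) (r : Z ⟶ W) (hr : (S.f ≫ j) ≫ r = 0) (s : S.X₃ ⟶ W) (t : W ⟶ B)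
      (hst : s ≫ t = 0),
      IsProper 𝒞 (ShortComplex.mk (S.f ≫ j) r hr) ∧ IsProper 𝒞 (ShortComplex.mk s t hst) := by
  obtain ⟨W, r, s, t, hst, sq : IsPushout j S.g r s, hrt : r ≫ t = q, hs⟩ := hT.exists_pushout S.g
  have := hS.mono_f
  have : Mono j := hT.mono_f
  have := hS.epi_g
  have : Epi r := (MorphismProperty.epimorphisms 𝒜).of_isPushout sq
    (MorphismProperty.epimorphisms.infer_property S.g)
  refine ⟨W, r, by rw [Category.assoc, sq.w, S.zero_assoc, zero_comp], s, t, hst,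
    ⟨.mk' (exact_of_exists_desc fun T k hk => ?_) (mono_comp S.f j) ‹_›,
      fun C hC (f : C ⟶ W) => ?_⟩, hs⟩
  · obtain ⟨l, hl⟩ := hS.exists_desc (j ≫ k) (by simpa using hk)
    exact ⟨sq.desc k l hl.symm, sq.inl_desc _ _ _⟩
  · obtain ⟨g, hg : g ≫ q = f ≫ t⟩ := hT.lift hC (f ≫ t)
    obtain ⟨l, hl : l ≫ s = f - g ≫ r⟩ := hs.exists_lift (f - g ≫ r) (by simp [hrt, hg])
    obtain ⟨m, hm⟩ := hS.lift hC l
    exact ⟨g + m ≫ j, by simp [sq.w, reassoc_of% hm, hl]⟩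

lemma comp_epi (hS : IsProper 𝒞 S) {V W : 𝒜} {j : V ⟶ S.X₃} {q : S.X₃ ⟶ W} {hjq : j ≫ q = 0}
    (hT : IsProper 𝒞 (ShortComplex.mk j q hjq)) :
    ∃ (U : 𝒜) (r : U ⟶ S.X₂) (hr : r ≫ S.g ≫ q = 0) (s : S.X₁ ⟶ U) (t : U ⟶ V)
      (hst : s ≫ t = 0),
      IsProper 𝒞 (ShortComplex.mk r (S.g ≫ q) hr) ∧ IsProper 𝒞 (ShortComplex.mk s t hst) ∧
        s ≫ r = S.f := by
  obtain ⟨U, r, t, s, hst, sq, hsr, hs⟩ := hS.exists_pullback j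
  have : Mono j := hT.mono_f
  have : Epi q := hT.epi_g
  have := hS.epi_g
  have : Mono r := (MorphismProperty.monomorphisms 𝒜).of_isPullback sq.flip
    (MorphismProperty.monomorphisms.infer_property j)
  refine ⟨U, r, by rw [sq.w_assoc, hjq, comp_zero], s, t, hst,
    ⟨.mk' (exact_of_exists_lift fun T k hk => ?_) ‹_› (epi_comp S.g q),
      fun C hC (f : C ⟶ W) => ?_⟩, hs, hsr⟩
  · obtain ⟨l, hl⟩ := hT.exists_lift (k ≫ S.g) (by simpa using hk)
    exact ⟨sq.lift k l hl.symm, sq.lift_fst _ _ _⟩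
  · obtain ⟨g, hg : g ≫ q = f⟩ := hT.lift hC f
    obtain ⟨l, hl⟩ := hS.lift hC g
    exact ⟨l, by simp [reassoc_of% hl, hg]⟩

lemma biprod_map_id_left (hS : IsProper 𝒞 S) (W : 𝒜) :
    IsProper 𝒞 (ShortComplex.mk (biprod.map (𝟙 W) S.f) (biprod.snd ≫ S.g) (by simp)) := by
  have := hS.mono_f
  have := hS.epi_g
  refine ⟨.mk' (exact_of_exists_lift fun T (k : T ⟶ W ⊞ S.X₂) hk => ?_)
    (inferInstanceAs (Mono (biprod.map (𝟙 W) S.f))) (epi_comp biprod.snd S.g), fun C hC f => ?_⟩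
  · obtain ⟨l, hl⟩ := hS.exists_lift (k ≫ biprod.snd) (by simpa using hk)
    exact ⟨biprod.lift (k ≫ biprod.fst) l, by ext <;> simp [hl]⟩
  · obtain ⟨g, hg⟩ := hS.lift hC f
    exact ⟨g ≫ biprod.inr, by simp [hg]⟩

lemma biprod_map_id_right (hS : IsProper 𝒞 S) (W : 𝒜) :
    IsProper 𝒞 (ShortComplex.mk (S.f ≫ biprod.inl) (biprod.map S.g (𝟙 W)) (by simp)) := by
  have := hS.mono_f
  have := hS.epi_g
  refine ⟨.mk' (exact_of_exists_lift fun T (k : T ⟶ S.X₂ ⊞ W) hk => ?_)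
    (mono_comp S.f biprod.inl) (inferInstanceAs (Epi (biprod.map S.g (𝟙 W)))),
    fun C hC (f : C ⟶ S.X₃ ⊞ W) => ?_⟩
  · obtain ⟨l, hl⟩ := hS.exists_lift (k ≫ biprod.fst) (by simpa using hk =≫ biprod.fst)
    have hk₂ : k ≫ biprod.snd = 0 := by simpa using hk =≫ biprod.snd
    exact ⟨l, by ext <;> simp [hl, hk₂]⟩
  · obtain ⟨g, hg⟩ := hS.lift hC (f ≫ biprod.fst)
    exact ⟨biprod.lift g (f ≫ biprod.snd), by ext <;> simp [hg]⟩

end IsProper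

end Proper

/-! ### Gorenstein objects and their syzygies -/

section Gorenstein

section

variable [HasEpiApproximations 𝒞]

lemma exists_isProper (𝒞 : ObjectProperty 𝒜) [HasEpiApproximations 𝒞] (M : 𝒜) :
    ∃ (K C : 𝒜) (i : K ⟶ C) (p : C ⟶ M) (h : i ≫ p = 0), 𝒞 C ∧
      IsProper 𝒞 (ShortComplex.mk i p h) := by
  obtain ⟨C, p, hp, hp'⟩ := HasEpiApproximations.exists_epi (𝒞 := 𝒞) M
  exact ⟨_, C, kernel.ι p, p, kernel.condition p, hp.1,
    .mk' (ShortComplex.exact_of_f_is_kernel _ (kernelIsKernel p)) inferInstance hp', hp.2⟩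

lemma exact_of_forall_lift {S : ShortComplex 𝒜} (h : ∀ ⦃C : 𝒜⦄ (_ : 𝒞 C) (f : C ⟶ S.X₂),
    f ≫ S.g = 0 → ∃ g : C ⟶ S.X₁, g ≫ S.f = f) : S.Exact := by
  rw [ShortComplex.exact_iff_epi_kernel_lift]
  obtain ⟨C, f, hC, hf⟩ := exists_epi_of_hasEpiApproximations 𝒞 (kernel S.g)
  obtain ⟨g, hg⟩ := h hC (f ≫ kernel.ι S.g) (by simp)
  have fac : g ≫ kernel.lift S.g S.f S.zero = f := by
    rw [← cancel_mono (kernel.ι _), Category.assoc, kernel.lift_ι, hg]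
  exact epi_of_epi_fac fac

lemma IsHomFromExact.acyclic {K : CochainComplex 𝒜 ℤ} (hK : IsHomFromExact 𝒞 K) :
    K.Acyclic := by
  rw [isHomFromExact_iff] at hK
  intro j
  rw [HomologicalComplex.exactAt_iff' _ (j - 1) j (j + 1) (by simp) (by simp)]
  exact exact_of_forall_lift fun C hC => hK C hC (j - 1) j (j + 1) (by lia) rfl

lemma IsProper.of_shortExact_map {S : ShortComplex 𝒜}
    (h : ∀ C : 𝒜, 𝒞 C → (S.map (preadditiveCoyoneda.obj (op C))).ShortExact) :
    IsProper 𝒞 S := by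
  have lift ⦃C : 𝒜⦄ (hC : 𝒞 C) : Function.Surjective fun g : C ⟶ S.X₂ => g ≫ S.g :=
    (AddCommGrpCat.epi_iff_surjective _).1 (h C hC).epi_g
  refine ⟨.mk' (exact_of_forall_lift fun C hC => (ShortComplex.ab_exact_iff _).1 (h C hC).exact)
    (Preadditive.mono_of_cancel_zero _ fun {T} k hk => ?_) ?_, lift⟩
  · obtain ⟨C, f, hC, hf⟩ := exists_epi_of_hasEpiApproximations 𝒞 T
    have : Function.Injective fun g : C ⟶ S.X₁ => g ≫ S.f :=
      (AddCommGrpCat.mono_iff_injective _).1 (h C hC).mono_f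
    rw [← cancel_epi f, comp_zero]
    exact this (by simp [hk])
  · obtain ⟨C, f, hC, hf⟩ := exists_epi_of_hasEpiApproximations 𝒞 S.X₃
    obtain ⟨g, hg⟩ := lift hC f
    exact epi_of_epi_fac hg

lemma gorensteinConflations_iff (S : ShortComplex (gorenstein 𝒞).FullSubcategory) :
    gorensteinConflations 𝒞 S ↔ IsProper 𝒞 (S.map (gorenstein 𝒞).ι) :=
  ⟨IsProper.of_shortExact_map, fun h _ => h.shortExact_map⟩

lemma gorenstein_of_family (S : ℤ → ShortComplex 𝒜) (e : ∀ i, (S i).X₃ ≅ (S (i + 1)).X₁)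
    (hS : ∀ i, 𝒞 (S i).X₂) (hp : ∀ i, IsProper 𝒞 (S i)) (hc : ∀ i, IsCoproper 𝒞 (S i)) :
    gorenstein 𝒞 (S (-1)).X₃ := by
  have hm (i) : Mono (S i).f := (hp i).mono_f
  have he (i) : Epi (S i).g := (hp i).epi_g
  let K : CochainComplex 𝒜 ℤ := CochainComplex.of (fun i => (S i).X₂)
    (fun i => (S i).g ≫ (e i).hom ≫ (S (i + 1)).f) (fun i => by simp)
  have hd (i : ℤ) : K.d i (i + 1) = (S i).g ≫ (e i).hom ≫ (S (i + 1)).f :=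
    CochainComplex.of_d (fun i => (S i).X₂) (fun i => (S i).g ≫ (e i).hom ≫ (S (i + 1)).f) i
  have h₁ : IsHomFromExact 𝒞 K := by
    rw [isHomFromExact_iff]
    rintro C hC i _ _ rfl rfl f hf
    rw [hd, ← Category.assoc, ← Category.assoc] at hf
    obtain ⟨g, hg⟩ := (hp (i + 1)).exists_lift f (zero_of_comp_mono _ (zero_of_comp_mono _ hf))
    obtain ⟨l, hl⟩ := (hp i).lift hC (g ≫ (e i).inv)
    exact ⟨l, by rw [hd, reassoc_of% hl, Iso.inv_hom_id_assoc, hg]⟩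
  have h₂ : IsHomToExact 𝒞 K := by
    rw [isHomToExact_iff]
    rintro C hC i _ _ rfl rfl f hf
    rw [hd, Category.assoc, Category.assoc] at hf
    obtain ⟨g, hg⟩ := (hp (i + 1)).exists_desc f (zero_of_epi_comp _ (zero_of_epi_comp _ hf))
    obtain ⟨l, hl⟩ := hc (i + 1 + 1) hC ((e (i + 1)).inv ≫ g)
    exact ⟨l, by rw [hd, Category.assoc, Category.assoc, hl, Iso.hom_inv_id_assoc, hg]⟩
  have : StrongEpi (S (-1)).g := strongEpi_of_epi _
  exact ⟨K, hS, h₁.acyclic, h₁, h₂,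
    ⟨image.isoStrongEpiMono (S (-1)).g ((e (-1)).hom ≫ (S (-1 + 1)).f) (hd (-1)).symm⟩⟩

end

/-- `M` is the quotient of an object of `𝒞` by an object of `𝒳`, via a sequence which is both
proper and coproper. -/
def HasSyzygyIn (𝒞 𝒳 : ObjectProperty 𝒜) (M : 𝒜) : Prop :=
  ∃ (K P : 𝒜) (i : K ⟶ P) (p : P ⟶ M) (h : i ≫ p = 0), 𝒳 K ∧ 𝒞 P ∧
    IsProper 𝒞 (ShortComplex.mk i p h) ∧ IsCoproper 𝒞 (ShortComplex.mk i p h)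

/-- `M` embeds into an object of `𝒞` with cokernel in `𝒳`, via a sequence which is both proper and
coproper. -/
def HasCosyzygyIn (𝒞 𝒳 : ObjectProperty 𝒜) (M : 𝒜) : Prop :=
  ∃ (Q N : 𝒜) (i : M ⟶ Q) (p : Q ⟶ N) (h : i ≫ p = 0), 𝒞 Q ∧ 𝒳 N ∧
    IsProper 𝒞 (ShortComplex.mk i p h) ∧ IsCoproper 𝒞 (ShortComplex.mk i p h)

lemma le_gorenstein [HasEpiApproximations 𝒞] {𝒳 : ObjectProperty 𝒜}
    (hl : ∀ M, 𝒳 M → HasSyzygyIn 𝒞 𝒳 M) (hr : ∀ M, 𝒳 M → HasCosyzygyIn 𝒞 𝒳 M) :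
    𝒳 ≤ gorenstein 𝒞 := by
  intro M hM
  choose K P i p hip hK hP hlp hlc using fun M : 𝒳.FullSubcategory => hl M.obj M.property
  choose Q N j q hjq hQ hN hrp hrc using fun M : 𝒳.FullSubcategory => hr M.obj M.property
  let syz (n : ℕ) : 𝒳.FullSubcategory := n.rec ⟨M, hM⟩ fun _ X => ⟨K X, hK X⟩
  let cosyz (n : ℕ) : 𝒳.FullSubcategory := n.rec ⟨M, hM⟩ fun _ X => ⟨N X, hN X⟩
  let S : ℤ → ShortComplex 𝒜
    | .ofNat n => .mk _ _ (hjq (cosyz n))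
    | .negSucc n => .mk _ _ (hip (syz n))
  let e : ∀ i, (S i).X₃ ≅ (S (i + 1)).X₁
    | .ofNat n => Iso.refl (N (cosyz n))
    | .negSucc 0 => Iso.refl M
    | .negSucc (n + 1) => Iso.refl (K (syz n))
  exact gorenstein_of_family S e (Int.rec (hQ <| cosyz ·) (hP <| syz ·))
    (Int.rec (hrp <| cosyz ·) (hlp <| syz ·)) (Int.rec (hrc <| cosyz ·) (hlc <| syz ·))

/-- The images of all the differentials of totally `𝒞`-acyclic complexes, with an arbitrary
epi-mono factorization of the differential in place of the image. -/
def IsTotallyAcyclicImage (𝒞 : ObjectProperty 𝒜) : ObjectProperty 𝒜 := fun M =>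
  ∃ K : CochainComplex 𝒜 ℤ, (∀ i, 𝒞 (K.X i)) ∧ IsHomFromExact 𝒞 K ∧ IsHomToExact 𝒞 K ∧
    ∃ (i j : ℤ) (p : K.X i ⟶ M) (ι : M ⟶ K.X j), i + 1 = j ∧ Epi p ∧ Mono ι ∧ p ≫ ι = K.d i j

section

variable {K : CochainComplex 𝒜 ℤ} {i j k : ℤ} {M N : 𝒜} {p : K.X i ⟶ M} {ι : M ⟶ K.X j}
  {q : K.X j ⟶ N} {κ : N ⟶ K.X k}

lemma comp_eq_zero_of_fac [Epi p] [Mono κ] (hp : p ≫ ι = K.d i j) (hq : q ≫ κ = K.d j k) :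
    ι ≫ q = 0 := by
  rw [← cancel_epi p, ← cancel_mono κ]
  simp [reassoc_of% hp, hq]

lemma IsHomFromExact.isProper [HasEpiApproximations 𝒞] (hK : IsHomFromExact 𝒞 K) [Epi p] [Mono ι]
    [Epi q] [Mono κ] (hij : i + 1 = j) (hjk : j + 1 = k) (hp : p ≫ ι = K.d i j)
    (hq : q ≫ κ = K.d j k) :
    IsProper 𝒞 (ShortComplex.mk ι q (comp_eq_zero_of_fac hp hq)) := by
  rw [isHomFromExact_iff] at hK
  refine ⟨.mk' (exact_of_forall_lift (𝒞 := 𝒞) fun C hC f (hf : f ≫ q = 0) => ?_) ‹_› ‹_›,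
    fun C hC (f : C ⟶ N) => ?_⟩
  · obtain ⟨g, hg⟩ := hK C hC i j k hij hjk f (by rw [← hq, reassoc_of% hf, zero_comp])
    exact ⟨g ≫ p, by rw [Category.assoc, hp, hg]⟩
  · have hκ : κ ≫ K.d k (k + 1) = 0 := by rw [← cancel_epi q, reassoc_of% hq]; simp
    obtain ⟨g, hg⟩ := hK C hC j k (k + 1) hjk rfl (f ≫ κ) (by rw [Category.assoc, hκ, comp_zero])
    exact ⟨g, by rw [← cancel_mono κ, Category.assoc, hq, hg]⟩

lemma IsHomToExact.isCoproper (hK : IsHomToExact 𝒞 K) [Epi p] [Mono ι] [Mono κ]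
    (hij : i + 1 = j) (hp : p ≫ ι = K.d i j) (hq : q ≫ κ = K.d j k) :
    IsCoproper 𝒞 (ShortComplex.mk ι q (comp_eq_zero_of_fac hp hq)) := by
  rw [isHomToExact_iff] at hK
  intro C hC (f : M ⟶ C)
  have h : K.d (i - 1) i ≫ p = 0 := by rw [← cancel_mono ι, Category.assoc, hp]; simp
  obtain ⟨g, hg⟩ := hK C hC (i - 1) i j (by lia) hij (p ≫ f) (by rw [reassoc_of% h, zero_comp])
  exact ⟨g, by rw [← cancel_epi p, reassoc_of% hp, hg]⟩

end

section

variable [HasEpiApproximations 𝒞]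

lemma IsTotallyAcyclicImage.hasSyzygyIn {M : 𝒜} (hM : IsTotallyAcyclicImage 𝒞 M) :
    HasSyzygyIn 𝒞 (IsTotallyAcyclicImage 𝒞) M := by
  obtain ⟨K, hC, h₁, h₂, i, j, p, ι, hij, hp, hι, fac⟩ := hM
  have fac' := image.fac (K.d (i - 1) i)
  exact ⟨_, K.X i, image.ι (K.d (i - 1) i), p, comp_eq_zero_of_fac fac' fac,
    ⟨K, hC, h₁, h₂, i - 1, i, _, _, by lia, inferInstance, inferInstance, fac'⟩, hC i,
    h₁.isProper (by lia) hij fac' fac, h₂.isCoproper (by lia) fac' fac⟩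

lemma IsTotallyAcyclicImage.hasCosyzygyIn {M : 𝒜} (hM : IsTotallyAcyclicImage 𝒞 M) :
    HasCosyzygyIn 𝒞 (IsTotallyAcyclicImage 𝒞) M := by
  obtain ⟨K, hC, h₁, h₂, i, j, p, ι, hij, hp, hι, fac⟩ := hM
  have fac' := image.fac (K.d j (j + 1))
  exact ⟨K.X j, _, ι, factorThruImage (K.d j (j + 1)), comp_eq_zero_of_fac fac fac', hC j,
    ⟨K, hC, h₁, h₂, j, j + 1, _, _, rfl, inferInstance, inferInstance, fac'⟩,
    h₁.isProper hij rfl fac fac', h₂.isCoproper hij fac fac'⟩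

variable (𝒞) in
lemma gorenstein_eq : gorenstein 𝒞 = IsTotallyAcyclicImage 𝒞 := by
  refine le_antisymm ?_ (le_gorenstein (fun _ h => h.hasSyzygyIn) (fun _ h => h.hasCosyzygyIn))
  rintro M ⟨K, hC, -, h₁, h₂, ⟨e⟩⟩
  exact ⟨K, hC, h₁, h₂, -1, 0, factorThruImage _ ≫ e.inv, e.hom ≫ image.ι _, rfl, epi_comp _ _,
    mono_comp _ _, by simp⟩

lemma gorenstein.hasSyzygyIn {M : 𝒜} (hM : gorenstein 𝒞 M) : HasSyzygyIn 𝒞 (gorenstein 𝒞) M := by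
  rw [gorenstein_eq] at hM ⊢
  exact hM.hasSyzygyIn

lemma gorenstein.hasCosyzygyIn {M : 𝒜} (hM : gorenstein 𝒞 M) :
    HasCosyzygyIn 𝒞 (gorenstein 𝒞) M := by
  rw [gorenstein_eq] at hM ⊢
  exact hM.hasCosyzygyIn

end

section

variable {S : ShortComplex 𝒜}

lemma IsProper.nonempty_splitting (hS : IsProper 𝒞 S) (h : 𝒞 S.X₃) : Nonempty S.Splitting :=
  let ⟨s, hs⟩ := hS.exists_section h
  ⟨.ofExactOfSection _ hS.shortExact.exact s hs hS.mono_f⟩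

lemma IsProper.nonempty_splitting_of_hasSyzygyIn {𝒳 : ObjectProperty 𝒜} (hS : IsProper 𝒞 S)
    (h₁ : 𝒞 S.X₁) (h₃ : HasSyzygyIn 𝒞 𝒳 S.X₃) : Nonempty S.Splitting := by
  obtain ⟨K, P, i, p, hip, -, hP, hp, hc⟩ := h₃
  have : Epi p := hp.epi_g
  obtain ⟨l, hl⟩ := hS.lift hP p
  obtain ⟨m, hm⟩ := hS.exists_lift (i ≫ l) (by rw [Category.assoc, hl, hip])
  obtain ⟨g, hg : i ≫ g = m⟩ := hc h₁ m
  obtain ⟨s, hs : p ≫ s = l - g ≫ S.f⟩ := hp.exists_desc (l - g ≫ S.f) (by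
    simp [reassoc_of% hg, hm])
  refine ⟨.ofExactOfSection _ hS.shortExact.exact s ?_ hS.mono_f⟩
  rw [← cancel_epi p, reassoc_of% hs]
  simp [hl]

lemma IsProper.isCoproper_of_hasSyzygyIn {𝒳 : ObjectProperty 𝒜} (hS : IsProper 𝒞 S)
    (h₃ : HasSyzygyIn 𝒞 𝒳 S.X₃) : IsCoproper 𝒞 S := by
  intro C hC f
  obtain ⟨Y, b, v, w, hv, sq, -, hT⟩ := hS.exists_pushout f
  obtain ⟨s⟩ := hT.nonempty_splitting_of_hasSyzygyIn hC h₃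
  exact ⟨b ≫ s.r, by rw [sq.w_assoc, s.f_r, Category.comp_id]⟩

lemma IsProper.isCoproper [HasEpiApproximations 𝒞] (hS : IsProper 𝒞 S)
    (h₃ : gorenstein 𝒞 S.X₃) : IsCoproper 𝒞 S :=
  hS.isCoproper_of_hasSyzygyIn h₃.hasSyzygyIn

lemma IsProper.comp_iso {X Y Z Z' : 𝒜} {i : X ⟶ Y} {p : Y ⟶ Z} {hip : i ≫ p = 0}
    (hS : IsProper 𝒞 (ShortComplex.mk i p hip)) (e : Z ≅ Z') :
    IsProper 𝒞 (ShortComplex.mk i (p ≫ e.hom) (by rw [reassoc_of% hip, zero_comp])) :=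
  IsProper.of_iso (S := .mk i p hip) (ShortComplex.isoMk (Iso.refl X) (Iso.refl Y) e) hS

lemma IsProper.iso_comp {X X' Y Z : 𝒜} {i : X ⟶ Y} {p : Y ⟶ Z} {hip : i ≫ p = 0}
    (hS : IsProper 𝒞 (ShortComplex.mk i p hip)) (e : X' ≅ X) :
    IsProper 𝒞 (ShortComplex.mk (e.hom ≫ i) p (by rw [Category.assoc, hip, comp_zero])) :=
  IsProper.of_iso (S := .mk i p hip) (ShortComplex.isoMk e.symm (Iso.refl Y) (Iso.refl Z)) hS

end

end Gorenstein

section Extensions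

/-- `P` is closed under extensions by `𝒞`-proper short exact sequences. -/
class IsClosedUnderProperExtensions (𝒞 P : ObjectProperty 𝒜) : Prop where
  of_isProper {S : ShortComplex 𝒜} (hS : IsProper 𝒞 S) (h₁ : P S.X₁) (h₃ : P S.X₃) : P S.X₂

/-- The proper extensions of objects of the Gorenstein category. -/
def IsGorensteinExtension (𝒞 : ObjectProperty 𝒜) : ObjectProperty 𝒜 := fun M =>
  ∃ (L N : 𝒜) (f : L ⟶ M) (g : M ⟶ N) (h : f ≫ g = 0), gorenstein 𝒞 L ∧ gorenstein 𝒞 N ∧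
    IsProper 𝒞 (ShortComplex.mk f g h)

variable [HasEpiApproximations 𝒞]

lemma IsProper.isCoproper_of_isGorensteinExtension {S : ShortComplex 𝒜} (hS : IsProper 𝒞 S)
    (h₃ : IsGorensteinExtension 𝒞 S.X₃) : IsCoproper 𝒞 S := by
  obtain ⟨L, N, f, g, h, hL, hN, hT⟩ := h₃
  obtain ⟨U, r, hr, s, t, hst, h₁, h₂, fac⟩ := hS.comp_epi hT
  intro C hC a
  obtain ⟨b, hb : s ≫ b = a⟩ := h₂.isCoproper hL hC a
  obtain ⟨c, hc : r ≫ c = b⟩ := h₁.isCoproper hN hC b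
  exact ⟨c, by rw [← fac, Category.assoc, hc, hb]⟩

variable [𝒞.IsClosedUnderBinaryProducts]

lemma IsGorensteinExtension.hasSyzygyIn {M : 𝒜} (hM : IsGorensteinExtension 𝒞 M) :
    HasSyzygyIn 𝒞 (IsGorensteinExtension 𝒞) M := by
  obtain ⟨L, N, f, g, h, hL, hN, hS⟩ := id hM
  obtain ⟨K₁, P₁, i₁, p₁, z₁, hK₁, hP₁, h₁, -⟩ := hL.hasSyzygyIn
  obtain ⟨K₂, P₂, i₂, p₂, z₂, hK₂, hP₂, h₂, -⟩ := hN.hasSyzygyIn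
  obtain ⟨E, a, q, j, hj, sq, -, hE⟩ := hS.exists_pullback p₂
  have hE' := h₂.pullback sq.flip (j := sq.lift 0 i₂ (by simp [z₂]))
    (sq.lift_snd _ _ _) (sq.lift_fst _ _ _)
  obtain ⟨σ⟩ := hE.nonempty_splitting hP₂
  obtain ⟨U, r, hr, s, t, hst, k₁, k₂, -⟩ :=
    ((h₁.biprod_map_id_right P₂).comp_iso σ.isoBinaryBiproduct.symm).comp_epi hE'
  exact ⟨_, _, _, _, hr, ⟨_, _, s, t, hst, hK₁, hK₂, k₂⟩, prop_biprod 𝒞 hP₁ hP₂, k₁,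
    k₁.isCoproper_of_isGorensteinExtension hM⟩

lemma IsGorensteinExtension.hasCosyzygyIn {M : 𝒜} (hM : IsGorensteinExtension 𝒞 M) :
    HasCosyzygyIn 𝒞 (IsGorensteinExtension 𝒞) M := by
  obtain ⟨L, N, f, g, h, hL, hN, hS⟩ := hM
  obtain ⟨Q₁, N₁, i₁, p₁, z₁, hQ₁, hN₁, h₁, -⟩ := hL.hasCosyzygyIn
  obtain ⟨Q₂, N₂, i₂, p₂, z₂, hQ₂, hN₂, h₂, -⟩ := hN.hasCosyzygyIn
  obtain ⟨E, b, v, w, hv, sq, -, hE⟩ := hS.exists_pushout i₁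
  have hE' := h₁.pushout sq.flip (w := sq.desc 0 p₁ (by simp [z₁]))
    (sq.inr_desc _ _ _) (sq.inl_desc _ _ _)
  obtain ⟨σ⟩ := hE.nonempty_splitting_of_hasSyzygyIn hQ₁ hN.hasSyzygyIn
  obtain ⟨W, r, hr, s, t, hst, k₁, k₂⟩ :=
    hE'.comp_mono ((h₂.biprod_map_id_left Q₁).iso_comp σ.isoBinaryBiproduct)
  have hW : IsGorensteinExtension 𝒞 W := ⟨_, _, s, t, hst, hN₁, hN₂, k₂⟩
  exact ⟨_, _, _, _, hr, prop_biprod 𝒞 hQ₁ hQ₂, hW, k₁, k₁.isCoproper_of_isGorensteinExtension hW⟩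

instance : IsClosedUnderProperExtensions 𝒞 (gorenstein 𝒞) where
  of_isProper {S} hS h₁ h₃ :=
    le_gorenstein (𝒳 := IsGorensteinExtension 𝒞) (fun _ h => h.hasSyzygyIn)
      (fun _ h => h.hasCosyzygyIn) _ ⟨_, _, _, _, S.zero, h₁, h₃, hS⟩

end Extensions

/-! ### The Frobenius structure -/

section ExactStructure

/-- The `𝒞`-proper short exact sequences with terms in `P`. -/
def properConflations (𝒞 P : ObjectProperty 𝒜) : ObjectProperty (ShortComplex P.FullSubcategory) :=
  fun S => IsProper 𝒞 (S.map P.ι)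

variable {P : ObjectProperty 𝒜}

lemma isInflation_properConflations_iff {X Y : P.FullSubcategory} (i : X ⟶ Y) :
    IsInflation (properConflations 𝒞 P) i ↔ ∃ (Z : 𝒜) (p : Y.obj ⟶ Z) (h : i.hom ≫ p = 0),
      P Z ∧ IsProper 𝒞 (ShortComplex.mk i.hom p h) where
  mp := fun ⟨Z, p, h, hS⟩ => ⟨Z.obj, p.hom, congr_arg (·.hom) h, Z.property, hS⟩
  mpr := fun ⟨Z, p, h, hZ, hS⟩ => ⟨⟨Z, hZ⟩, ObjectProperty.homMk p, by ext; exact h, hS⟩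

lemma isDeflation_properConflations_iff {Y Z : P.FullSubcategory} (p : Y ⟶ Z) :
    IsDeflation (properConflations 𝒞 P) p ↔ ∃ (X : 𝒜) (i : X ⟶ Y.obj) (h : i ≫ p.hom = 0),
      P X ∧ IsProper 𝒞 (ShortComplex.mk i p.hom h) where
  mp := fun ⟨X, i, h, hS⟩ => ⟨X.obj, i.hom, congr_arg (·.hom) h, X.property, hS⟩
  mpr := fun ⟨X, i, h, hX, hS⟩ => ⟨⟨X, hX⟩, ObjectProperty.homMk i, by ext; exact h, hS⟩

lemma properConflations.isKernel {S : ShortComplex P.FullSubcategory}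
    (hS : properConflations 𝒞 P S) : Nonempty (IsLimit (KernelFork.ofι S.f S.zero)) :=
  ⟨isLimitOfReflects P.ι <| (KernelFork.isLimitMapConeEquiv (.ofι S.f S.zero) P.ι).symm <|
    hS.shortExact.fIsKernel⟩

lemma properConflations.isCokernel {S : ShortComplex P.FullSubcategory}
    (hS : properConflations 𝒞 P S) : Nonempty (IsColimit (CokernelCofork.ofπ S.g S.zero)) :=
  ⟨isColimitOfReflects P.ι <|
    (CokernelCofork.isColimitMapCoconeEquiv (.ofπ S.g S.zero) P.ι).symm <|
      hS.shortExact.gIsCokernel⟩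

lemma isExactStructure_properConflations (𝒞 P : ObjectProperty 𝒜) [P.ContainsZero]
    [P.IsClosedUnderIsomorphisms] [IsClosedUnderProperExtensions 𝒞 P] :
    IsExactStructure (properConflations 𝒞 P) where
  of_iso e hS := IsProper.of_iso (P.ι.mapShortComplex.mapIso e) hS
  isKernel _ hS := hS.isKernel
  isCokernel _ hS := hS.isCokernel
  id_inflation X := (isInflation_properConflations_iff _).2
    ⟨0, 0, comp_zero, P.prop_zero, IsProper.of_isZero_X₃ (isZero_zero _)⟩
  id_deflation X := (isDeflation_properConflations_iff _).2
    ⟨0, 0, zero_comp, P.prop_zero, IsProper.of_isZero_X₁ (isZero_zero _)⟩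
  comp_inflation f g hf hg := by
    rw [isInflation_properConflations_iff] at hf hg ⊢
    obtain ⟨A, p, _, hA, hp⟩ := hf
    obtain ⟨B, q, _, hB, hq⟩ := hg
    obtain ⟨W, r, hr, s, t, _, h, hst⟩ := hp.comp_mono hq
    exact ⟨W, r, hr, IsClosedUnderProperExtensions.of_isProper hst hA hB, h⟩
  comp_deflation f g hf hg := by
    rw [isDeflation_properConflations_iff] at hf hg ⊢
    obtain ⟨A, i, _, hA, hi⟩ := hf
    obtain ⟨B, j, _, hB, hj⟩ := hg
    obtain ⟨U, r, hr, s, t, _, h, hst, -⟩ := hi.comp_epi hj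
    exact ⟨U, r, hr, IsClosedUnderProperExtensions.of_isProper hst hA hB, h⟩
  pushout_inflation {_ _ X'} i f hi := by
    obtain ⟨A, p, _, hA, hp⟩ := (isInflation_properConflations_iff _).1 hi
    obtain ⟨Y, b, j, q, hjq, sq, -, h⟩ := hp.exists_pushout f.hom
    have hY : P Y := IsClosedUnderProperExtensions.of_isProper h X'.property hA
    exact ⟨⟨Y, hY⟩, ObjectProperty.homMk b, ObjectProperty.homMk j,
      IsPushout.of_map P.ι (by ext; exact sq.w) sq,
      (isInflation_properConflations_iff _).2 ⟨A, q, hjq, hA, h⟩⟩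
  pullback_deflation {_ _ Z'} p f hp := by
    obtain ⟨A, i, _, hA, hi⟩ := (isDeflation_properConflations_iff _).1 hp
    obtain ⟨Y, a, q, j, hjq, sq, -, h⟩ := hi.exists_pullback f.hom
    have hY : P Y := IsClosedUnderProperExtensions.of_isProper h hA Z'.property
    exact ⟨⟨Y, hY⟩, ObjectProperty.homMk a, ObjectProperty.homMk q,
      IsPullback.of_map P.ι (by ext; exact sq.w) sq,
      (isDeflation_properConflations_iff _).2 ⟨A, j, hjq, hA, h⟩⟩

lemma properConflations.isPushout_hom [IsClosedUnderProperExtensions 𝒞 P]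
    {S : ShortComplex P.FullSubcategory} (hS : properConflations 𝒞 P S) {M Z : P.FullSubcategory}
    {u : S.X₁ ⟶ M} {b : S.X₂ ⟶ Z} {v : M ⟶ Z} (sq : IsPushout S.f u b v) :
    IsPushout S.f.hom u.hom b.hom v.hom := by
  obtain ⟨Z₀, b₀, v₀, w, _, sq₀, -, hZ₀⟩ :=
    IsProper.exists_pushout (S := .mk S.f.hom S.g.hom (S.map P.ι).zero) hS u.hom
  let Z' : P.FullSubcategory :=
    ⟨Z₀, IsClosedUnderProperExtensions.of_isProper hZ₀ M.property S.X₃.property⟩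
  have sq' : IsPushout S.f u (ObjectProperty.homMk b₀ : S.X₂ ⟶ Z') (ObjectProperty.homMk v₀) :=
    IsPushout.of_map P.ι (by ext; exact sq₀.w) sq₀
  refine sq₀.of_iso (Iso.refl _) (Iso.refl _) (Iso.refl _)
    (P.ι.mapIso (sq'.isoIsPushout _ _ sq)) (by simp) (by simp) ?_ ?_
  · exact (congr_arg (·.hom) (sq'.inl_isoIsPushout_hom _ _ sq)).trans (Category.id_comp _).symm
  · exact (congr_arg (·.hom) (sq'.inr_isoIsPushout_hom _ _ sq)).trans (Category.id_comp _).symm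

end ExactStructure

section Frobenius

variable [HasEpiApproximations 𝒞]

variable (𝒞) in
lemma gorensteinConflations_eq :
    gorensteinConflations 𝒞 = properConflations 𝒞 (gorenstein 𝒞) := by
  ext S
  exact gorensteinConflations_iff S

variable [𝒞.ContainsZero] [𝒞.IsClosedUnderIsomorphisms]

variable (𝒞) in
lemma le_gorenstein_self : 𝒞 ≤ gorenstein 𝒞 :=
  le_gorenstein
    (fun M hM => ⟨0, M, 0, 𝟙 M, zero_comp, 𝒞.prop_zero, hM, .of_isZero_X₁ (isZero_zero _),
      fun _ _ _ => ⟨0, (isZero_zero 𝒜).eq_of_src _ _⟩⟩)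
    (fun M hM => ⟨M, 0, 𝟙 M, 0, comp_zero, hM, 𝒞.prop_zero, .of_isZero_X₃ (isZero_zero _),
      fun _ _ f => ⟨f, Category.id_comp f⟩⟩)

lemma gorenstein.exists_isDeflation (X : (gorenstein 𝒞).FullSubcategory) :
    ∃ (P : (gorenstein 𝒞).FullSubcategory) (p : P ⟶ X), 𝒞 P.obj ∧
      IsDeflation (gorensteinConflations 𝒞) p := by
  obtain ⟨K, P, i, p, h, hK, hP, hp, -⟩ := gorenstein.hasSyzygyIn X.property
  rw [gorensteinConflations_eq]
  exact ⟨⟨P, le_gorenstein_self 𝒞 P hP⟩, ObjectProperty.homMk p, hP,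
    (isDeflation_properConflations_iff _).2 ⟨K, i, h, hK, hp⟩⟩

lemma gorenstein.exists_isInflation (X : (gorenstein 𝒞).FullSubcategory) :
    ∃ (Q : (gorenstein 𝒞).FullSubcategory) (i : X ⟶ Q), 𝒞 Q.obj ∧
      IsInflation (gorensteinConflations 𝒞) i := by
  obtain ⟨Q, N, i, p, h, hQ, hN, hp, -⟩ := gorenstein.hasCosyzygyIn X.property
  rw [gorensteinConflations_eq]
  exact ⟨⟨Q, le_gorenstein_self 𝒞 Q hQ⟩, ObjectProperty.homMk i, hQ,
    (isInflation_properConflations_iff _).2 ⟨N, p, h, hN, hp⟩⟩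

variable {X : (gorenstein 𝒞).FullSubcategory}

lemma isRelProjective_gorensteinConflations_iff :
    IsRelProjective (gorensteinConflations 𝒞) X ↔ 𝒞.retractClosure X.obj := by
  refine ⟨fun hX => ?_, fun ⟨C, hC, ⟨r⟩⟩ Y Z p hp f => ?_⟩
  · obtain ⟨P, p, hP, hp⟩ := gorenstein.exists_isDeflation X
    obtain ⟨s, hs⟩ := hX p hp (𝟙 X)
    exact ⟨P.obj, hP, ⟨s.hom, p.hom, congr_arg (·.hom) hs⟩⟩
  · rw [gorensteinConflations_eq, isDeflation_properConflations_iff] at hp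
    obtain ⟨A, i, _, -, hi⟩ := hp
    obtain ⟨g, hg : g ≫ p.hom = r.r ≫ f.hom⟩ := hi.lift hC (r.r ≫ f.hom)
    exact ⟨ObjectProperty.homMk (r.i ≫ g), by ext; simp [hg]⟩

lemma isRelInjective_gorensteinConflations_iff :
    IsRelInjective (gorensteinConflations 𝒞) X ↔ 𝒞.retractClosure X.obj := by
  refine ⟨fun hX => ?_, fun ⟨C, hC, ⟨r⟩⟩ Y Z i hi f => ?_⟩
  · obtain ⟨Q, i, hQ, hi⟩ := gorenstein.exists_isInflation X
    obtain ⟨s, hs⟩ := hX i hi (𝟙 X)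
    exact ⟨Q.obj, hQ, ⟨i.hom, s.hom, congr_arg (·.hom) hs⟩⟩
  · rw [gorensteinConflations_eq, isInflation_properConflations_iff] at hi
    obtain ⟨A, p, _, hA, hp⟩ := hi
    obtain ⟨g, hg : i.hom ≫ g = f.hom ≫ r.i⟩ := hp.isCoproper hA hC (f.hom ≫ r.i)
    exact ⟨ObjectProperty.homMk (g ≫ r.r), by ext; simp [reassoc_of% hg]⟩

variable (𝒞) in
theorem isFrobenius_gorensteinConflations [𝒞.IsClosedUnderBinaryProducts] :
    IsFrobenius (gorensteinConflations 𝒞) where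
  exact := by
    rw [gorensteinConflations_eq]
    exact isExactStructure_properConflations 𝒞 (gorenstein 𝒞)
  enough_projectives X := by
    obtain ⟨P, p, hP, hp⟩ := gorenstein.exists_isDeflation X
    exact ⟨P, p, isRelProjective_gorensteinConflations_iff.2 (𝒞.le_retractClosure _ hP), hp⟩
  enough_injectives X := by
    obtain ⟨Q, i, hQ, hi⟩ := gorenstein.exists_isInflation X
    exact ⟨Q, i, isRelInjective_gorensteinConflations_iff.2 (𝒞.le_retractClosure _ hQ), hi⟩
  projective_iff_injective X := by
    rw [isRelProjective_gorensteinConflations_iff, isRelInjective_gorensteinConflations_iff]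

end Frobenius

/-! ### The bounded relative derived category -/

section Triangles

variable {T : Type u} [Category.{v} T] [HasZeroObject T] [HasShift T ℤ] [Preadditive T]
  [∀ n : ℤ, (shiftFunctor T n).Additive] [Pretriangulated T]

lemma mem_distTriang_of_iso {X Y Z X' Y' Z' : T} {f : X ⟶ Y} {g : Y ⟶ Z} {h : Z ⟶ X⟦(1 : ℤ)⟧}
    (hT : Triangle.mk f g h ∈ distTriang T) {f' : X' ⟶ Y'} {g' : Y' ⟶ Z'}
    {h' : Z' ⟶ X'⟦(1 : ℤ)⟧} (e₁ : X' ≅ X) (e₂ : Y' ≅ Y) (e₃ : Z' ≅ Z)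
    (comm₁ : f' ≫ e₂.hom = e₁.hom ≫ f) (comm₂ : g' ≫ e₃.hom = e₂.hom ≫ g)
    (comm₃ : h' ≫ e₁.hom⟦(1 : ℤ)⟧' = e₃.hom ≫ h) :
    Triangle.mk f' g' h' ∈ distTriang T :=
  isomorphic_distinguished _ hT _ (Triangle.isoMk _ _ e₁ e₂ e₃ comm₁ comm₂ comm₃)

lemma mem_distTriang_of_iso₃ {X Y Z Z' : T} {f : X ⟶ Y} {g : Y ⟶ Z} {h : Z ⟶ X⟦(1 : ℤ)⟧}
    (hT : Triangle.mk f g h ∈ distTriang T) {g' : Y ⟶ Z'}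
    {h' : Z' ⟶ X⟦(1 : ℤ)⟧} (e : Z ≅ Z') (hg : g ≫ e.hom = g') (hh : e.hom ≫ h' = h) :
    Triangle.mk f g' h' ∈ distTriang T :=
  mem_distTriang_of_iso hT (Iso.refl _) (Iso.refl _) e.symm (by simp) (by simp [← hg])
    (by simp [← hh])

end Triangles

/-- The complex `K` vanishes outside the degrees between `a` and `b`. -/
def IsConcentrated (K : CochainComplex 𝒜 ℤ) (a b : ℤ) : Prop :=
  ∀ i : ℤ, i < a ∨ b < i → IsZero (K.X i)

variable (𝒜) in
/-- Bounded complexes. -/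
def isBounded : ObjectProperty (CochainComplex 𝒜 ℤ) := fun K => ∃ a b : ℤ, IsConcentrated K a b

lemma isConcentrated_single (X : 𝒜) (n : ℤ) :
    IsConcentrated ((CochainComplex.singleFunctor 𝒜 n).obj X) n n :=
  fun i hi => HomologicalComplex.isZero_single_obj_X (ComplexShape.up ℤ) n X i (by lia)

lemma isBounded_single (X : 𝒜) (n : ℤ) : isBounded 𝒜 ((CochainComplex.singleFunctor 𝒜 n).obj X) :=
  ⟨n, n, isConcentrated_single X n⟩

variable (𝒜) in
/-- The category of bounded complexes. -/
abbrev BoundedComplex : Type _ := (isBounded 𝒜).FullSubcategory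

variable (𝒜) in
/-- The quotient functor from bounded complexes to the bounded homotopy category. -/
def BoundedComplex.toKb : BoundedComplex 𝒜 ⥤ Kb 𝒜 :=
  (boundedIn (⊤ : ObjectProperty 𝒜)).lift ((isBounded 𝒜).ι ⋙ HomotopyCategory.quotient _ _)
    (fun K => ⟨K.property, fun _ => trivial⟩)

variable (𝒞) in
/-- The functor from bounded complexes to the bounded relative derived category. -/
abbrev BoundedComplex.toDb : BoundedComplex 𝒜 ⥤ Db 𝒞 := BoundedComplex.toKb 𝒜 ⋙ Db.Q 𝒞

variable (𝒜) in
/-- The complexes concentrated in a single degree, as bounded complexes. -/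
def BoundedComplex.single (n : ℤ) : 𝒜 ⥤ BoundedComplex 𝒜 :=
  (isBounded 𝒜).lift (CochainComplex.singleFunctor 𝒜 n) (fun X => isBounded_single X n)

variable (𝒞) in
/-- The functor `𝒜 ⥤ D^b_𝒞(𝒜)`. -/
abbrev Db.single : 𝒜 ⥤ Db 𝒞 := Kb.single 𝒜 ⋙ Db.Q 𝒞

lemma BoundedComplex.toKb_map_surjective {K L : BoundedComplex 𝒜}
    (f : (toKb 𝒜).obj K ⟶ (toKb 𝒜).obj L) : ∃ g : K ⟶ L, (toKb 𝒜).map g = f := by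
  obtain ⟨g, hg⟩ := (HomotopyCategory.quotient 𝒜 (ComplexShape.up ℤ)).map_surjective
    (X := K.obj) (Y := L.obj) ((Kb.ι 𝒜).map f)
  exact ⟨ObjectProperty.homMk g, (Kb.ι 𝒜).map_injective hg⟩

lemma BoundedComplex.toKb_obj_surjective (X : Kb 𝒜) :
    ∃ K : BoundedComplex 𝒜, (toKb 𝒜).obj K = X :=
  ⟨⟨X.obj.as, X.property.1⟩, rfl⟩

lemma BoundedComplex.toKb_map_eq_zero {K L : BoundedComplex 𝒜}
    (h : ∀ i, IsZero (K.obj.X i) ∨ IsZero (L.obj.X i)) (f : (toKb 𝒜).obj K ⟶ (toKb 𝒜).obj L) :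
    f = 0 := by
  obtain ⟨g, rfl⟩ := toKb_map_surjective f
  have : g.hom = 0 := by
    ext i
    obtain h | h := h i
    · exact h.eq_of_src _ _
    · exact h.eq_of_tgt _ _
  obtain rfl : g = 0 := by ext : 1; exact this
  apply (Kb.ι 𝒜).map_injective
  exact (HomotopyCategory.quotient 𝒜 (ComplexShape.up ℤ)).map_zero _ _

lemma isBounded_shift {K : CochainComplex 𝒜 ℤ} (hK : isBounded 𝒜 K) (n : ℤ) :
    isBounded 𝒜 (K⟦n⟧) := by
  obtain ⟨a, b, h⟩ := hK
  exact ⟨a - n, b - n, fun i hi => h (i + n) (by lia)⟩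

/-- The shift of a bounded complex. -/
abbrev BoundedComplex.shift (K : BoundedComplex 𝒜) (n : ℤ) : BoundedComplex 𝒜 :=
  ⟨K.obj⟦n⟧, isBounded_shift K.property n⟩

/-- The functor to the bounded homotopy category is compatible with the shifts. -/
def BoundedComplex.toKbShiftIso (K : BoundedComplex 𝒜) (n : ℤ) :
    (toKb 𝒜).obj (K.shift n) ≅ ((toKb 𝒜).obj K)⟦n⟧ :=
  (Kb.ι 𝒜).preimageIso
    (((HomotopyCategory.quotient 𝒜 (ComplexShape.up ℤ)).commShiftIso n).app K.obj ≪≫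
      (((Kb.ι 𝒜).commShiftIso n).app ((toKb 𝒜).obj K)).symm)

variable (𝒞) in
/-- The functor to the bounded relative derived category is compatible with the shifts. -/
def BoundedComplex.toDbShiftIso (K : BoundedComplex 𝒜) (n : ℤ) :
    (toDb 𝒞).obj (K.shift n) ≅ ((toDb 𝒞).obj K)⟦n⟧ :=
  (Db.Q 𝒞).mapIso (K.toKbShiftIso n) ≪≫ ((Db.Q 𝒞).commShiftIso n).app _

/-- Complexes concentrated in one degree as shifts of complexes concentrated in degree `0`. -/
def BoundedComplex.shiftSingleIso (X : 𝒜) (n m : ℤ) (h : n + m = 0) :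
    ((single 𝒜 0).obj X).shift n ≅ (single 𝒜 m).obj X :=
  (isBounded 𝒜).ι.preimageIso (((CochainComplex.singleFunctors 𝒜).shiftIso n m 0 h).app X)

variable (𝒞) in
/-- The image in the bounded relative derived category of a complex concentrated in one degree. -/
def Db.singleIso (X : 𝒜) (n m : ℤ) (h : n + m = 0) :
    (BoundedComplex.toDb 𝒞).obj ((BoundedComplex.single 𝒜 m).obj X) ≅
      ((Db.single 𝒞).obj X)⟦n⟧ :=
  (BoundedComplex.toDb 𝒞).mapIso (BoundedComplex.shiftSingleIso X n m h).symm ≪≫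
    BoundedComplex.toDbShiftIso 𝒞 _ n

lemma acyclicIn_trW_iff {K L : CochainComplex 𝒜 ℤ} (f : K ⟶ L) :
    (acyclicIn 𝒞).trW ((HomotopyCategory.quotient _ _).map f) ↔
      IsHomFromExact 𝒞 (CochainComplex.mappingCone f) :=
  (acyclicIn 𝒞).trW_iff_of_distinguished _
    (HomotopyCategory.mappingCone_triangleh_distinguished f)

lemma Kb.acyclic_trW_iff {K L : BoundedComplex 𝒜} (f : K ⟶ L) :
    (Kb.acyclic 𝒞).trW ((BoundedComplex.toKb 𝒜).map f) ↔
      IsHomFromExact 𝒞 (CochainComplex.mappingCone f.hom) :=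
  ((acyclicIn 𝒞).inverseImage_trW_iff (Kb.ι 𝒜) _).trans (acyclicIn_trW_iff f.hom)

lemma isHomFromExact_mappingCone_descShortComplex (S : ShortComplex (CochainComplex 𝒜 ℤ))
    (hS : ∀ i, IsProper 𝒞 (S.map (HomologicalComplex.eval 𝒜 (ComplexShape.up ℤ) i))) :
    IsHomFromExact 𝒞
      (CochainComplex.mappingCone (CochainComplex.mappingCone.descShortComplex S)) := by
  intro C hC
  let F := preadditiveCoyoneda.obj (op C)
  have hS' : (S.map (F.mapHomologicalComplex (ComplexShape.up ℤ))).ShortExact :=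
    HomologicalComplex.shortExact_of_degreewise_shortExact _
      (fun i => (hS i).shortExact_map hC)
  have h₁ := CochainComplex.mappingCone.quasiIso_descShortComplex hS'
  have h₂ : QuasiIso ((F.mapHomologicalComplex (ComplexShape.up ℤ)).map
      (CochainComplex.mappingCone.descShortComplex S)) := by
    rw [← CochainComplex.mappingCone.mapHomologicalComplexIso_hom_descShortComplex]
    have h₀ : QuasiIso (CochainComplex.mappingCone.mapHomologicalComplexIso S.f F).hom :=
      quasiIso_of_isIso _
    exact (quasiIso_iff_comp_left _ _).2 h₁
  have h₃ := (HomotopyCategory.quotient_map_mem_quasiIso_iff _).2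
    (HomologicalComplex.mem_quasiIso_iff _ |>.2 h₂)
  rw [HomotopyCategory.quasiIso_eq_trW_subcategoryAcyclic] at h₃
  have h₄ := ((HomotopyCategory.subcategoryAcyclic _).trW_iff_of_distinguished _
    (HomotopyCategory.mappingCone_triangleh_distinguished _)).1 h₃
  exact (HomotopyCategory.quotient_obj_mem_subcategoryAcyclic_iff_acyclic _).1
    (ObjectProperty.prop_of_iso _ ((HomotopyCategory.quotient _ _).mapIso
      (CochainComplex.mappingCone.mapHomologicalComplexIso _ F).symm) h₄)

lemma isBounded_mappingCone {K L : CochainComplex 𝒜 ℤ} (hK : isBounded 𝒜 K)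
    (hL : isBounded 𝒜 L) (f : K ⟶ L) : isBounded 𝒜 (CochainComplex.mappingCone f) := by
  obtain ⟨a₁, b₁, h₁⟩ := hK
  obtain ⟨a₂, b₂, h₂⟩ := hL
  exact ⟨min (a₁ - 1) a₂, max b₁ b₂, fun i hi =>
    (CochainComplex.mappingCone.isZero_X_iff f i).2 ⟨h₁ _ (by lia), h₂ _ (by lia)⟩⟩

lemma exists_mappingCone_triangle {K L : BoundedComplex 𝒜} (f : K ⟶ L) :
    let M : BoundedComplex 𝒜 := ⟨CochainComplex.mappingCone f.hom,
      isBounded_mappingCone K.property L.property f.hom⟩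
    let i : L ⟶ M := ObjectProperty.homMk (CochainComplex.mappingCone.inr f.hom)
    ∃ h, Triangle.mk ((BoundedComplex.toKb 𝒜).map f) ((BoundedComplex.toKb 𝒜).map i) h ∈
      distTriang (Kb 𝒜) := by
  intro M i
  obtain ⟨Z, g, h, hT⟩ := distinguished_cocone_triangle ((BoundedComplex.toKb 𝒜).map f)
  let e := isoTriangleOfIso₁₂ _ _ ((Kb.ι 𝒜).map_distinguished _ hT)
    (HomotopyCategory.mappingCone_triangleh_distinguished f.hom) (Iso.refl _) (Iso.refl _)
    ((Category.comp_id _).trans (Category.id_comp _).symm)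
  let e' : Z ≅ (BoundedComplex.toKb 𝒜).obj M := (Kb.ι 𝒜).preimageIso (Triangle.π₃.mapIso e)
  have he' : g ≫ e'.hom = (BoundedComplex.toKb 𝒜).map i := by
    apply (Kb.ι 𝒜).map_injective
    rw [Functor.map_comp, show (Kb.ι 𝒜).map e'.hom = e.hom.hom₃ from (Kb.ι 𝒜).map_preimage _]
    exact e.hom.comm₂.trans (Category.id_comp _)
  exact ⟨e'.inv ≫ h, mem_distTriang_of_iso₃ hT e' he' (by simp)⟩

lemma exists_distinguished_of_isProper {K L M : BoundedComplex 𝒜} (f : K ⟶ L) (g : L ⟶ M)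
    (w : f.hom ≫ g.hom = 0)
    (hS : ∀ i, IsProper 𝒞 (ShortComplex.mk (f.hom.f i) (g.hom.f i)
      (by rw [← HomologicalComplex.comp_f, w, HomologicalComplex.zero_f]))) :
    ∃ δ, Triangle.mk ((BoundedComplex.toDb 𝒞).map f) ((BoundedComplex.toDb 𝒞).map g) δ ∈
      distTriang (Db 𝒞) := by
  obtain ⟨h, hT⟩ := exists_mappingCone_triangle f
  let N : BoundedComplex 𝒜 := ⟨CochainComplex.mappingCone f.hom,
      isBounded_mappingCone K.property L.property f.hom⟩
  let i : L ⟶ N := ObjectProperty.homMk (CochainComplex.mappingCone.inr f.hom)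
  let S := ShortComplex.mk f.hom g.hom w
  let s : N ⟶ M := ObjectProperty.homMk (CochainComplex.mappingCone.descShortComplex S)
  have hs : (Kb.acyclic 𝒞).trW ((BoundedComplex.toKb 𝒜).map s) :=
    (Kb.acyclic_trW_iff s).2
      (isHomFromExact_mappingCone_descShortComplex S (fun j => hS j))
  have : IsIso ((BoundedComplex.toDb 𝒞).map s) :=
    Localization.inverts (Db.Q 𝒞) (Kb.acyclic 𝒞).trW _ hs
  have his : (BoundedComplex.toDb 𝒞).map i ≫ (BoundedComplex.toDb 𝒞).map s =
      (BoundedComplex.toDb 𝒞).map g := by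
    rw [← Functor.map_comp]
    congr 1
    ext : 1
    exact CochainComplex.mappingCone.inr_descShortComplex S
  exact ⟨inv ((BoundedComplex.toDb 𝒞).map s) ≫ (Db.Q 𝒞).map h ≫
      ((Db.Q 𝒞).commShiftIso (1 : ℤ)).hom.app _,
    mem_distTriang_of_iso₃ ((Db.Q 𝒞).map_distinguished _ hT)
      (@asIso _ _ _ _ _ this) his (IsIso.hom_inv_id_assoc _ _)⟩

section Truncation

section

variable {ι ι' : Type*} {c : ComplexShape ι} {c' : ComplexShape ι'}
  (K : HomologicalComplex 𝒜 c') (e : c.Embedding c') [e.IsTruncGE] {i : ι} {i' j' : ι'}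

lemma isIso_πTruncGE_f (hi' : e.f i = i') (hi : ¬ e.BoundaryGE i) :
    IsIso ((K.πTruncGE e).f i') := by
  have := K.isIso_restrictionToTruncGE' e i hi
  rw [HomologicalComplex.πTruncGE, e.liftExtend_f _ _ hi']
  exact IsIso.comp_isIso' inferInstance (IsIso.comp_isIso' this
    ((K.truncGE' e).extendXIso e hi').isIso_inv)

lemma exists_desc_πTruncGE_f (hi' : e.f i = i') (hi : e.BoundaryGE i) (hij : c'.prev i' = j')
    {T : 𝒜} (y : K.X i' ⟶ T) (hy : K.d j' i' ≫ y = 0) :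
    ∃ z : (K.truncGE e).X i' ⟶ T, (K.πTruncGE e).f i' ≫ z = y := by
  change ∃ z : ((K.truncGE' e).extend e).X i' ⟶ T,
    (e.liftExtend _ (K.restrictionToTruncGE'_hasLift e)).f i' ≫ z = y
  refine ⟨((K.truncGE' e).extendXIso e hi').hom ≫ (K.truncGE'XIsoOpcycles e hi' hi).hom ≫
    K.descOpcycles y j' hij hy, ?_⟩
  simp [e.liftExtend_f _ _ hi', K.restrictionToTruncGE'_f_eq_iso_hom_pOpcycles_iso_inv e hi' hi]

end

variable (X : CochainComplex 𝒜 ℤ) {n i : ℤ}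

lemma mono_ιTruncLE_f : Mono ((X.ιTruncLE n).f i) :=
  inferInstanceAs (Mono ((HomologicalComplex.ιTruncLE _ _).f i))

lemma isIso_ιTruncLE_f (hi : i < n) : IsIso ((X.ιTruncLE n).f i) := by
  have := isIso_πTruncGE_f X.op (ComplexShape.embeddingUpIntLE n).op (i := (n - i).toNat)
    (i' := i) (show n - ((n - i).toNat : ℤ) = i by lia)
    (by simp [ComplexShape.boundaryLE_embeddingUpIntLE_iff]; lia)
  exact inferInstanceAs (IsIso ((X.op.πTruncGE (ComplexShape.embeddingUpIntLE n).op).f i).unop)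

lemma exists_lift_ιTruncLE_f {T : 𝒜} (y : T ⟶ X.X n) (hy : y ≫ X.d n (n + 1) = 0) :
    ∃ z : T ⟶ (X.truncLE n).X n, z ≫ (X.ιTruncLE n).f n = y := by
  obtain ⟨z, hz⟩ := exists_desc_πTruncGE_f X.op (ComplexShape.embeddingUpIntLE n).op
    (i := 0) (i' := n) (by simp)
    (by simp [ComplexShape.boundaryLE_embeddingUpIntLE_iff]) (ComplexShape.prev_eq' _ rfl)
    y.op (congr_arg Quiver.Hom.op hy)
  exact ⟨z.unop, congr_arg Quiver.Hom.unop hz⟩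

lemma isHomFromExact_mappingCone {K L : CochainComplex 𝒜 ℤ} (f : K ⟶ L)
    (h : ∀ (C : 𝒜) (_ : 𝒞 C) (i j k : ℤ) (_ : i + 1 = j) (_ : j + 1 = k) (x : C ⟶ K.X k)
      (y : C ⟶ L.X j), x ≫ K.d k (k + 1) = 0 → x ≫ f.f k = y ≫ L.d j k →
        ∃ (x' : C ⟶ K.X j) (y' : C ⟶ L.X i),
          x' ≫ K.d j k = x ∧ y = x' ≫ f.f j + y' ≫ L.d i j) :
    IsHomFromExact 𝒞 (CochainComplex.mappingCone f) := by
  rw [isHomFromExact_iff]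
  intro C hC i j k hij hjk c hc
  obtain ⟨x, y, rfl⟩ := CochainComplex.mappingCone.decomp_to f c k hjk
  rw [Preadditive.add_comp, Category.assoc, Category.assoc,
    CochainComplex.mappingCone.inl_v_d f k j (k + 1) (by lia) (by lia),
    CochainComplex.mappingCone.inr_f_d] at hc
  have h₁ := hc =≫ (CochainComplex.mappingCone.fst f).1.v k (k + 1) rfl
  have h₂ := hc =≫ (CochainComplex.mappingCone.snd f).v k k (add_zero k)
  simp only [Preadditive.comp_sub, Preadditive.add_comp, Preadditive.sub_comp, Category.assoc,
    CochainComplex.mappingCone.inr_f_fst_v, CochainComplex.mappingCone.inl_v_fst_v, comp_zero,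
    zero_comp, Category.comp_id, zero_sub, add_zero, neg_eq_zero,
    CochainComplex.mappingCone.inr_f_snd_v, CochainComplex.mappingCone.inl_v_snd_v,
    sub_zero] at h₁ h₂
  obtain ⟨x', y', h₃, h₄⟩ := h C hC i j k hij hjk x (-y) h₁
    (by rw [Preadditive.neg_comp, eq_neg_iff_add_eq_zero, h₂])
  obtain rfl : y = -(x' ≫ f.f j + y' ≫ L.d i j) := by rw [← h₄, neg_neg]
  refine ⟨-x' ≫ (CochainComplex.mappingCone.inl f).v j i (by lia) -
    y' ≫ (CochainComplex.mappingCone.inr f).f i, ?_⟩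
  rw [Preadditive.sub_comp, Preadditive.neg_comp, Category.assoc, Category.assoc,
    CochainComplex.mappingCone.inl_v_d f j i k (by lia) (by lia),
    CochainComplex.mappingCone.inr_f_d, Preadditive.comp_sub, reassoc_of% h₃]
  simp only [Preadditive.neg_comp, Preadditive.add_comp, Category.assoc]
  abel

lemma exists_lift_of_isHomFromExact_mappingCone {K L : CochainComplex 𝒜 ℤ} {f : K ⟶ L}
    (hf : IsHomFromExact 𝒞 (CochainComplex.mappingCone f)) {C : 𝒜} (hC : 𝒞 C) {i j : ℤ}
    (hij : i + 1 = j) (hL : IsZero (L.X j)) (x : C ⟶ K.X j) (hx : x ≫ K.d j (j + 1) = 0) :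
    ∃ y : C ⟶ K.X i, y ≫ K.d i j = x := by
  rw [isHomFromExact_iff] at hf
  obtain ⟨c, hc⟩ := hf C hC (i - 1) i j (by lia) hij
    (x ≫ (CochainComplex.mappingCone.inl f).v j i (by lia)) (by
      rw [Category.assoc, CochainComplex.mappingCone.inl_v_d f j i (j + 1) (by lia) (by lia),
        Preadditive.comp_sub, reassoc_of% hx, zero_comp, sub_zero, hL.eq_of_tgt (f.f j) 0,
        zero_comp, comp_zero])
  refine ⟨-c ≫ (CochainComplex.mappingCone.fst f).1.v (i - 1) i (by lia), ?_⟩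
  have := hc =≫ (CochainComplex.mappingCone.fst f).1.v i j hij
  simp only [Category.assoc, CochainComplex.mappingCone.inl_v_fst_v, Category.comp_id,
    CochainComplex.mappingCone.d_fst_v f (i - 1) i j (by lia) hij, Preadditive.comp_neg] at this
  rw [Preadditive.neg_comp, Category.assoc, this]

lemma isHomFromExact_mappingCone_ιTruncLE
    (hX : ∀ (C : 𝒜) (_ : 𝒞 C) (i j : ℤ) (_ : i + 1 = j) (_ : n < j) (x : C ⟶ X.X j),
      x ≫ X.d j (j + 1) = 0 → ∃ y : C ⟶ X.X i, y ≫ X.d i j = x) :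
    IsHomFromExact 𝒞 (CochainComplex.mappingCone (X.ιTruncLE n)) := by
  have hzero (i : ℤ) (hi : n < i) : IsZero ((X.truncLE n).X i) :=
    CochainComplex.isZero_of_isStrictlyLE _ n i hi
  refine isHomFromExact_mappingCone _ ?_
  rintro C hC i j k hij rfl x y hx hxy
  obtain hj | rfl | hj := lt_trichotomy j n
  · have := isIso_ιTruncLE_f X hj
    have := mono_ιTruncLE_f X (n := n) (i := j + 1)
    refine ⟨y ≫ inv ((X.ιTruncLE n).f j), 0, ?_, by simp⟩
    rw [← cancel_mono ((X.ιTruncLE n).f (j + 1)), Category.assoc, ← (X.ιTruncLE n).comm,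
      Category.assoc, IsIso.inv_hom_id_assoc, hxy]
  · obtain rfl : x = 0 := (hzero (j + 1) (by lia)).eq_of_tgt _ _
    obtain ⟨z, hz⟩ := exists_lift_ιTruncLE_f X y (by rw [← hxy, zero_comp])
    exact ⟨z, 0, (hzero (j + 1) (by lia)).eq_of_tgt _ _, by simp [hz]⟩
  · obtain rfl : x = 0 := (hzero (j + 1) (by lia)).eq_of_tgt _ _
    obtain ⟨z, hz⟩ := hX C hC i j hij hj y (by rw [← hxy, zero_comp])
    exact ⟨0, z, (hzero (j + 1) (by lia)).eq_of_tgt _ _, by simp [hz]⟩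

end Truncation

section DerivedHoms

lemma rightFraction_map_eq_zero {C D : Type*} [Category* C] [Category* D] [HasZeroMorphisms D]
    {W : MorphismProperty C} {X Y : C} (φ : W.RightFraction X Y) (F : C ⥤ D)
    (hF : W.IsInvertedBy F) (h : F.map φ.f = 0) : φ.map F hF = 0 := by
  have := hF _ φ.hs
  rw [← cancel_epi (F.map φ.s), MorphismProperty.RightFraction.map_s_comp_map, h, comp_zero]

lemma Db.hom_eq_zero (M : 𝒜) (Y : BoundedComplex 𝒜) (hY : ∀ i ≤ 0, IsZero (Y.obj.X i))
    (φ : (Db.single 𝒞).obj M ⟶ (BoundedComplex.toDb 𝒞).obj Y) : φ = 0 := by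
  obtain ⟨@⟨X', s, hs, f⟩, hφ⟩ :=
    Localization.exists_rightFraction (Db.Q 𝒞) (Kb.acyclic 𝒞).trW φ
  obtain ⟨X, rfl⟩ := BoundedComplex.toKb_obj_surjective X'
  obtain ⟨s', rfl⟩ := BoundedComplex.toKb_map_surjective
    (L := (BoundedComplex.single 𝒜 0).obj M) s
  have hs' : IsHomFromExact 𝒞 (CochainComplex.mappingCone s'.hom) := (Kb.acyclic_trW_iff s').1 hs
  have hb : isBounded 𝒜 (X.obj.truncLE 0) := by
    obtain ⟨a, b, hab⟩ := X.property
    have (i : ℤ) := mono_ιTruncLE_f X.obj (n := 0) (i := i)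
    exact ⟨a, b, fun i hi => (hab i hi).of_mono ((X.obj.ιTruncLE 0).f i)⟩
  let t : (⟨X.obj.truncLE 0, hb⟩ : BoundedComplex 𝒜) ⟶ X :=
    ObjectProperty.homMk (X.obj.ιTruncLE 0)
  have ht : (Kb.acyclic 𝒞).trW ((BoundedComplex.toKb 𝒜).map t) :=
    (Kb.acyclic_trW_iff t).2 (isHomFromExact_mappingCone_ιTruncLE X.obj
      fun C hC i j hij hj => exists_lift_of_isHomFromExact_mappingCone hs' hC hij
        (isConcentrated_single M 0 j (by lia)))
  have h₁ := Localization.inverts (Db.Q 𝒞) (Kb.acyclic 𝒞).trW _ ht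
  have h₂ : (BoundedComplex.toKb 𝒜).map t ≫ f = 0 :=
    BoundedComplex.toKb_map_eq_zero (fun i => by
      by_cases hi : i ≤ 0
      · exact Or.inr (hY i hi)
      · exact Or.inl (CochainComplex.isZero_of_isStrictlyLE _ 0 i (by lia))) _
  have h₃ : (Db.Q 𝒞).map f = 0 := by
    rw [← cancel_epi ((Db.Q 𝒞).map ((BoundedComplex.toKb 𝒜).map t)), ← Functor.map_comp, h₂,
      Functor.map_zero, comp_zero]
  rw [hφ]
  exact rightFraction_map_eq_zero _ _ _ h₃

lemma Db.hom_shift_eq_zero (M N : 𝒜)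
    (ψ : ((Db.single 𝒞).obj M)⟦(1 : ℤ)⟧ ⟶ (Db.single 𝒞).obj N) : ψ = 0 := by
  apply (shiftFunctor (Db 𝒞) (-1 : ℤ)).map_injective
  rw [Functor.map_zero, ← cancel_epi ((shiftShiftNeg ((Db.single 𝒞).obj M) (1 : ℤ)).inv),
    ← cancel_mono (Db.singleIso 𝒞 N (-1) 1 (by lia)).inv, comp_zero, zero_comp]
  exact Db.hom_eq_zero _ _ (fun i hi => isConcentrated_single N 1 i (by lia)) _

variable (𝒞) in
lemma acyclicIn_le [HasEpiApproximations 𝒞] :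
    acyclicIn 𝒞 ≤ HomotopyCategory.subcategoryAcyclic 𝒜 := by
  intro X hX
  obtain ⟨K, rfl⟩ := X.quotient_obj_surjective
  exact (HomotopyCategory.quotient_obj_mem_subcategoryAcyclic_iff_acyclic _).2
    (IsHomFromExact.acyclic hX)

lemma Db.single_faithful [HasEpiApproximations 𝒞] : (Db.single 𝒞).Faithful := by
  refine ⟨fun {M N f g} hfg => ?_⟩
  obtain ⟨Y, s, hs, hs'⟩ := (MorphismProperty.map_eq_iff_postcomp (Db.Q 𝒞)
    (Kb.acyclic 𝒞).trW _ _).1 hfg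
  rw [ObjectProperty.inverseImage_trW_iff] at hs
  replace hs := ObjectProperty.trW_monotone (acyclicIn_le 𝒞) _ hs
  rw [← HomotopyCategory.quasiIso_eq_trW_subcategoryAcyclic] at hs
  have hs₀ : IsIso ((HomotopyCategory.homologyFunctor 𝒜 (ComplexShape.up ℤ) 0).map
    ((Kb.ι 𝒜).map s)) := hs 0
  have h₁ := congr_arg (HomotopyCategory.homologyFunctor 𝒜 (ComplexShape.up ℤ) 0).map
    (congr_arg (Kb.ι 𝒜).map hs')
  rw [Functor.map_comp, Functor.map_comp, Functor.map_comp, Functor.map_comp,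
    cancel_mono] at h₁
  let e : HomotopyCategory.singleFunctor 𝒜 0 ⋙
      HomotopyCategory.homologyFunctor 𝒜 (ComplexShape.up ℤ) 0 ≅ 𝟭 𝒜 :=
    Functor.isoWhiskerLeft (HomologicalComplex.single 𝒜 (ComplexShape.up ℤ) 0)
      (HomotopyCategory.homologyFunctorFactors 𝒜 (ComplexShape.up ℤ) 0) ≪≫
      HomologicalComplex.homologyFunctorSingleIso 𝒜 (ComplexShape.up ℤ) 0
  have : (HomotopyCategory.singleFunctor 𝒜 0 ⋙
      HomotopyCategory.homologyFunctor 𝒜 (ComplexShape.up ℤ) 0).Faithful :=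
    Functor.Faithful.of_iso e.symm
  exact Functor.map_injective (HomotopyCategory.singleFunctor 𝒜 0 ⋙
      HomotopyCategory.homologyFunctor 𝒜 (ComplexShape.up ℤ) 0) h₁

variable {S S' : ShortComplex 𝒜}

lemma IsProper.exists_distinguished (hS : IsProper 𝒞 S) :
    ∃ δ, Triangle.mk ((Db.single 𝒞).map S.f) ((Db.single 𝒞).map S.g) δ ∈ distTriang (Db 𝒞) := by
  refine exists_distinguished_of_isProper ((BoundedComplex.single 𝒜 0).map S.f)
    ((BoundedComplex.single 𝒜 0).map S.g) ?_ fun j => ?_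
  · exact (S.map (CochainComplex.singleFunctor 𝒜 0)).zero
  · obtain rfl | hj := eq_or_ne j 0
    · exact hS.of_iso (S.mapNatIso
        (HomologicalComplex.singleCompEvalIsoSelf 𝒜 (ComplexShape.up ℤ) 0)).symm
    · have hX (X : 𝒜) := isConcentrated_single X 0 j (by lia)
      exact IsProper.of_splitting { r := 0, s := 0, f_r := (hX _).eq_of_src _ _,
                                    s_g := (hX _).eq_of_src _ _, id := (hX _).eq_of_src _ _ }

/-- The connecting morphism in `D^b_𝒞(𝒜)` of a proper short exact sequence. -/
def Db.δ (hS : IsProper 𝒞 S) :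
    (Db.single 𝒞).obj S.X₃ ⟶ ((Db.single 𝒞).obj S.X₁)⟦(1 : ℤ)⟧ :=
  hS.exists_distinguished.choose

lemma Db.distinguished (hS : IsProper 𝒞 S) :
    Triangle.mk ((Db.single 𝒞).map S.f) ((Db.single 𝒞).map S.g) (Db.δ hS) ∈ distTriang (Db 𝒞) :=
  hS.exists_distinguished.choose_spec

lemma Db.δ_naturality (hS : IsProper 𝒞 S) (hS' : IsProper 𝒞 S') (φ : S ⟶ S') :
    (Db.single 𝒞).map φ.τ₃ ≫ Db.δ hS' = Db.δ hS ≫ ((Db.single 𝒞).map φ.τ₁)⟦(1 : ℤ)⟧' := by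
  obtain ⟨c, hc₁, hc₂⟩ : ∃ c : (Db.single 𝒞).obj S.X₃ ⟶ (Db.single 𝒞).obj S'.X₃,
      (Db.single 𝒞).map S.g ≫ c = (Db.single 𝒞).map φ.τ₂ ≫ (Db.single 𝒞).map S'.g ∧
        Db.δ hS ≫ ((Db.single 𝒞).map φ.τ₁)⟦(1 : ℤ)⟧' = c ≫ Db.δ hS' :=
    complete_distinguished_triangle_morphism _ _ (Db.distinguished hS) (Db.distinguished hS')
      ((Db.single 𝒞).map φ.τ₁) ((Db.single 𝒞).map φ.τ₂)
      (((Db.single 𝒞).map_comp _ _).symm.trans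
        ((congr_arg (Db.single 𝒞).map φ.comm₁₂.symm).trans ((Db.single 𝒞).map_comp _ _)))
  obtain ⟨ψ, hψ⟩ : ∃ ψ : ((Db.single 𝒞).obj S.X₁)⟦(1 : ℤ)⟧ ⟶ (Db.single 𝒞).obj S'.X₃,
      c - (Db.single 𝒞).map φ.τ₃ = Db.δ hS ≫ ψ :=
    Triangle.yoneda_exact₃ _ (Db.distinguished hS) (c - (Db.single 𝒞).map φ.τ₃)
      (by
        change (Db.single 𝒞).map S.g ≫ (c - (Db.single 𝒞).map φ.τ₃) = 0
        rw [Preadditive.comp_sub, hc₁, ← Functor.map_comp, ← Functor.map_comp, φ.comm₂₃, sub_self])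
  obtain rfl : c = (Db.single 𝒞).map φ.τ₃ := by
    rw [← sub_eq_zero, hψ, Db.hom_shift_eq_zero _ _ ψ, comp_zero]
  exact hc₂.symm

end DerivedHoms

section DerivedOrthogonality

instance : (Kb.single 𝒜).Additive where
  map_add {_ _ f g} := (Kb.ι 𝒜).map_injective
    ((HomotopyCategory.singleFunctor 𝒜 0).map_add (f := f) (g := g))

lemma Db.map_bijective {K : BoundedComplex 𝒜} (hK : ∀ i, 𝒞 (K.obj.X i)) (L : BoundedComplex 𝒜) :
    Function.Bijective ((Db.Q 𝒞).map :
      ((BoundedComplex.toKb 𝒜).obj K ⟶ (BoundedComplex.toKb 𝒜).obj L) → _) :=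
  (Kb.sub_le_leftOrthogonal 𝒞 _ ⟨(HomotopyCategory.quotient _ _).obj K.obj, ⟨K.property, hK⟩,
    ⟨Iso.refl _⟩⟩).map_bijective_of_isTriangulated (Db.Q 𝒞) _

lemma BoundedComplex.toDb_map_surjective {K L : BoundedComplex 𝒜} (hK : ∀ i, 𝒞 (K.obj.X i))
    (f : (toDb 𝒞).obj K ⟶ (toDb 𝒞).obj L) : ∃ g : K ⟶ L, (toDb 𝒞).map g = f := by
  obtain ⟨g, rfl⟩ := (Db.map_bijective hK L).2 f
  obtain ⟨g, rfl⟩ := toKb_map_surjective g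
  exact ⟨g, rfl⟩

lemma BoundedComplex.toDb_map_eq_zero {K L : BoundedComplex 𝒜} (hK : ∀ i, 𝒞 (K.obj.X i))
    (h : ∀ i, IsZero (K.obj.X i) ∨ IsZero (L.obj.X i))
    (f : (toDb 𝒞).obj K ⟶ (toDb 𝒞).obj L) : f = 0 := by
  obtain ⟨g, rfl⟩ := (Db.map_bijective hK L).2 f
  rw [toKb_map_eq_zero h g, Functor.map_zero]

variable [𝒞.ContainsZero] [𝒞.IsClosedUnderIsomorphisms]

lemma prop_single_X {C : 𝒜} (hC : 𝒞 C) (n i : ℤ) :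
    𝒞 (((BoundedComplex.single 𝒜 n).obj C).obj.X i) := by
  obtain rfl | hi := eq_or_ne i n
  · exact 𝒞.prop_of_iso (HomologicalComplex.singleObjXSelf (ComplexShape.up ℤ) i C).symm hC
  · exact 𝒞.prop_of_isZero (isConcentrated_single C n i (by lia))

lemma Db.hom_single_eq_zero {P : 𝒜} (hP : 𝒞 P) (N : 𝒜) {a m : ℤ} (h : a + m ≠ 0)
    (φ : (BoundedComplex.toDb 𝒞).obj ((BoundedComplex.single 𝒜 a).obj P) ⟶
      ((Db.single 𝒞).obj N)⟦m⟧) : φ = 0 := by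
  rw [← cancel_mono (Db.singleIso 𝒞 N m (-m) (by lia)).inv, zero_comp]
  refine BoundedComplex.toDb_map_eq_zero (prop_single_X hP a) (fun i => ?_) _
  obtain rfl | hi := eq_or_ne i a
  · exact Or.inr (isConcentrated_single N (-m) i (by lia))
  · exact Or.inl (isConcentrated_single P a i (by lia))

variable {S : ShortComplex 𝒜}

lemma Db.exists_eq_δ_comp (hS : IsProper 𝒞 S) (h₂ : 𝒞 S.X₂) {N : 𝒜} {m : ℤ} (hm : m ≠ 0)
    (φ : (Db.single 𝒞).obj S.X₃ ⟶ ((Db.single 𝒞).obj N)⟦m⟧) :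
    ∃ ψ : ((Db.single 𝒞).obj S.X₁)⟦(1 : ℤ)⟧ ⟶ ((Db.single 𝒞).obj N)⟦m⟧, φ = Db.δ hS ≫ ψ :=
  Triangle.yoneda_exact₃ _ (Db.distinguished hS) φ
    (Db.hom_single_eq_zero (a := 0) h₂ N (by simpa using hm) _)

variable [HasEpiApproximations 𝒞]

lemma Db.single_full : (Db.single 𝒞).Full where
  map_surjective {M N} φ := by
    have := Db.single_faithful (𝒞 := 𝒞)
    obtain ⟨K, C, i, p, h, hC, hS⟩ := exists_isProper 𝒞 M
    obtain ⟨f, hf⟩ : ∃ f : C ⟶ N, (Db.single 𝒞).map f = (Db.single 𝒞).map p ≫ φ := by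
      obtain ⟨f, hf⟩ := BoundedComplex.toDb_map_surjective
        (L := (BoundedComplex.single 𝒜 0).obj N) (prop_single_X hC 0) ((Db.single 𝒞).map p ≫ φ)
      obtain ⟨f', hf'⟩ := (HomologicalComplex.single 𝒜 (ComplexShape.up ℤ) 0).map_surjective f.hom
      obtain rfl : (BoundedComplex.single 𝒜 0).map f' = f := by ext : 1; exact hf'
      exact ⟨f', hf⟩
    obtain ⟨g, rfl⟩ := hS.exists_desc f ((Db.single 𝒞).map_injective (by
      rw [Functor.map_comp, hf, ← Functor.map_comp_assoc, h, Functor.map_zero, Functor.map_zero,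
        zero_comp]))
    obtain ⟨ψ, hψ⟩ : ∃ ψ : ((Db.single 𝒞).obj K)⟦(1 : ℤ)⟧ ⟶ (Db.single 𝒞).obj N,
        (Db.single 𝒞).map g - φ = Db.δ hS ≫ ψ :=
      Triangle.yoneda_exact₃ _ (Db.distinguished hS) ((Db.single 𝒞).map g - φ) (by
        change (Db.single 𝒞).map p ≫ ((Db.single 𝒞).map g - φ) = 0
        rw [Preadditive.comp_sub, ← Functor.map_comp, hf, sub_self])
    refine ⟨g, ?_⟩
    rw [← sub_eq_zero, hψ, Db.hom_shift_eq_zero _ _ ψ, comp_zero]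

lemma Db.hom_single_shift_eq_zero {C : 𝒜} (hC : 𝒞 C) (n : ℕ) {m : ℤ} (hm : m = n + 1) {M : 𝒜}
    (hM : gorenstein 𝒞 M) (φ : (Db.single 𝒞).obj M ⟶ ((Db.single 𝒞).obj C)⟦m⟧) : φ = 0 := by
  induction n generalizing m M with
  | zero =>
    obtain ⟨K, P, i, p, h, -, hP, hS, hS'⟩ := hM.hasSyzygyIn
    obtain rfl : m = 1 := by simpa using hm
    obtain ⟨ψ, rfl⟩ := Db.exists_eq_δ_comp hS hP one_ne_zero φ
    have := Db.single_full (𝒞 := 𝒞)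
    obtain ⟨ψ, rfl⟩ := (shiftFunctor (Db 𝒞) (1 : ℤ)).map_surjective ψ
    obtain ⟨g, rfl⟩ := (Db.single 𝒞).map_surjective ψ
    obtain ⟨g', hg⟩ := hS' hC g
    obtain rfl : i ≫ g' = g := hg
    have hδ : Db.δ hS ≫ ((Db.single 𝒞).map i)⟦(1 : ℤ)⟧' = 0 :=
      comp_distTriang_mor_zero₃₁ _ (Db.distinguished hS)
    rw [Functor.map_comp, Functor.map_comp, ← Category.assoc, hδ, zero_comp]
  | succ n ih =>
    obtain ⟨K, P, i, p, h, hK, hP, hS, -⟩ := hM.hasSyzygyIn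
    obtain ⟨ψ, rfl⟩ := Db.exists_eq_δ_comp hS hP (by lia) φ
    let e := (shiftFunctorAdd' (Db 𝒞) (m - 1) 1 m (by lia)).app ((Db.single 𝒞).obj C)
    obtain ⟨ψ', hψ'⟩ := (shiftFunctor (Db 𝒞) (1 : ℤ)).map_surjective (ψ ≫ e.hom)
    rw [ih (by push_cast at hm; lia) hK ψ', Functor.map_zero] at hψ'
    rw [← cancel_mono e.hom, Category.assoc, ← hψ', comp_zero, zero_comp]

end DerivedOrthogonality

section TopDegree

lemma exists_shortExact_single (K : CochainComplex 𝒜 ℤ) {b : ℤ} (hK : ∀ i, b < i → IsZero (K.X i)) :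
    ∃ (K' : CochainComplex 𝒜 ℤ) (f : (CochainComplex.singleFunctor 𝒜 b).obj (K.X b) ⟶ K)
      (g : K ⟶ K') (w : f ≫ g = 0), (ShortComplex.mk f g w).ShortExact ∧
        IsZero (K'.X b) ∧ ∀ i ≠ b, IsIso (g.f i) := by
  let f : (CochainComplex.singleFunctor 𝒜 b).obj (K.X b) ⟶ K :=
    HomologicalComplex.mkHomFromSingle (𝟙 _) fun j hj =>
      (hK j (Int.lt_of_add_one_le (le_of_eq hj))).eq_of_tgt _ _
  have hfb : IsIso (f.f b) := by
    dsimp only [f]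
    rw [HomologicalComplex.mkHomFromSingle_f, Category.comp_id]
    exact Iso.isIso_hom _
  have hf (i : ℤ) : Mono (f.f i) := by
    obtain rfl | hi := eq_or_ne i b
    · infer_instance
    · exact (isConcentrated_single (K.X b) b i (by lia)).mono _
  have : Mono f := HomologicalComplex.mono_of_mono_f _ hf
  have hS : (ShortComplex.mk f (cokernel.π f) (cokernel.condition f)).ShortExact :=
    ⟨ShortComplex.exact_cokernel f⟩
  have hSi (i : ℤ) := hS.map_of_exact (HomologicalComplex.eval 𝒜 (ComplexShape.up ℤ) i)
  exact ⟨_, f, cokernel.π f, cokernel.condition f, hS, (hSi b).isIso_f_iff.1 hfb,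
    fun i hi => (hSi i).isIso_g_iff.2 (isConcentrated_single (K.X b) b i (by lia))⟩

lemma exists_distinguished_single (K : BoundedComplex 𝒜) {a b : ℤ}
    (hK : IsConcentrated K.obj a b) :
    ∃ (K' : BoundedComplex 𝒜)
      (f : (BoundedComplex.toDb 𝒞).obj ((BoundedComplex.single 𝒜 b).obj (K.obj.X b)) ⟶
        (BoundedComplex.toDb 𝒞).obj K)
      (g : (BoundedComplex.toDb 𝒞).obj K ⟶ (BoundedComplex.toDb 𝒞).obj K')
      (h : (BoundedComplex.toDb 𝒞).obj K' ⟶ _), Triangle.mk f g h ∈ distTriang (Db 𝒞) ∧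
      IsConcentrated K'.obj a (b - 1) ∧
      ∀ i, IsZero (K'.obj.X i) ∨ Nonempty (K.obj.X i ≅ K'.obj.X i) := by
  obtain ⟨K', f, g, w, hS, hb, hg⟩ := exists_shortExact_single K.obj fun i hi => hK i (Or.inr hi)
  have hi (i : ℤ) : IsZero (K'.X i) ∨ Nonempty (K.obj.X i ≅ K'.X i) := by
    obtain rfl | h := eq_or_ne i b
    · exact Or.inl hb
    · have := hg i h
      exact Or.inr ⟨asIso (g.f i)⟩
  have hK' : IsConcentrated K' a (b - 1) := by
    intro i h
    obtain h₀ | ⟨⟨e⟩⟩ := hi i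
    · exact h₀
    · obtain rfl | h' := eq_or_ne i b
      · exact hb
      · exact (hK i (by lia)).of_iso e.symm
  let L : BoundedComplex 𝒜 := ⟨K', a, b - 1, hK'⟩
  obtain ⟨δ, hδ⟩ := exists_distinguished_of_isProper (𝒞 := 𝒞) (M := L)
    (K := (BoundedComplex.single 𝒜 b).obj (K.obj.X b))
    (ObjectProperty.homMk f) (ObjectProperty.homMk g) w fun i =>
      ⟨hS.map_of_exact (HomologicalComplex.eval 𝒜 (ComplexShape.up ℤ) i), fun C _ y => by
        obtain rfl | h := eq_or_ne i b
        · exact ⟨0, hb.eq_of_tgt _ _⟩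
        · have := hg i h
          exact ⟨y ≫ inv (g.f i), by simp⟩⟩
  exact ⟨L, _, _, δ, hδ, hK', hi⟩

lemma BoundedComplex.isZero_toDb {K : BoundedComplex 𝒜} (hK : ∀ i, IsZero (K.obj.X i)) :
    IsZero ((toDb 𝒞).obj K) := by
  refine (Db.Q 𝒞).map_isZero ?_
  rw [IsZero.iff_id_eq_zero]
  exact toKb_map_eq_zero (fun i => Or.inl (hK i)) _

lemma BoundedComplex.isZero_toDb_single (n : ℤ) {X : 𝒜} (hX : IsZero X) :
    IsZero ((toDb 𝒞).obj ((single 𝒜 n).obj X)) := by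
  refine isZero_toDb fun i => ?_
  obtain rfl | hi := eq_or_ne i n
  · exact hX.of_iso (HomologicalComplex.singleObjXSelf (ComplexShape.up ℤ) i X)
  · exact isConcentrated_single X n i (by lia)

lemma BoundedComplex.prop_toDb (E : ObjectProperty (Db 𝒞)) [E.IsTriangulatedClosed₂]
    [E.IsClosedUnderIsomorphisms] [E.ContainsZero] (K : BoundedComplex 𝒜)
    (hK : ∀ i, E ((toDb 𝒞).obj ((single 𝒜 i).obj (K.obj.X i)))) : E ((toDb 𝒞).obj K) := by
  obtain ⟨a, b, hab⟩ := K.property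
  obtain ⟨n, hn⟩ : ∃ n : ℕ, b < a + n := ⟨(b - a + 1).toNat, by lia⟩
  induction n generalizing b K with
  | zero => exact E.prop_of_isZero (isZero_toDb fun i => hab i (by lia))
  | succ n ih =>
    obtain ⟨K', f, g, h, hT, hK', e⟩ := exists_distinguished_single (𝒞 := 𝒞) K hab
    refine E.ext_of_isTriangulatedClosed₂ _ hT (hK b) (ih K' (fun i => ?_) (b - 1) hK' (by lia))
    obtain h₀ | ⟨⟨e⟩⟩ := e i
    · exact E.prop_of_isZero (isZero_toDb_single i h₀)
    · exact E.prop_of_iso ((toDb 𝒞).mapIso ((single 𝒜 i).mapIso e)) (hK i)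

end TopDegree

section GorensteinOrthogonality

variable [𝒞.ContainsZero] [𝒞.IsClosedUnderIsomorphisms]

lemma Db.hom_eq_zero_of_gorenstein [HasEpiApproximations 𝒞] {M : 𝒜} (hM : gorenstein 𝒞 M)
    {P : BoundedComplex 𝒜} (hP : ∀ i, 𝒞 (P.obj.X i)) (hP' : ∀ i, 0 ≤ i → IsZero (P.obj.X i))
    (φ : (Db.single 𝒞).obj M ⟶ (BoundedComplex.toDb 𝒞).obj P) : φ = 0 := by
  refine BoundedComplex.prop_toDb (.rightOrthogonal (.singleton ((Db.single 𝒞).obj M))) P ?_ φ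
    (.mk ())
  rintro i - φ ⟨⟩
  obtain hi | hi := lt_or_ge i 0
  · rw [← cancel_mono (Db.singleIso 𝒞 (P.obj.X i) (-i) i (by lia)).hom, zero_comp]
    exact Db.hom_single_shift_eq_zero (hP i) (-i - 1).toNat (by lia) hM _
  · exact (BoundedComplex.isZero_toDb_single i (hP' i hi)).eq_of_tgt _ _

lemma Db.exists_factorization_of_complex (n : ℕ) {N : 𝒜} (P : BoundedComplex 𝒜)
    (hP : ∀ i, 𝒞 (P.obj.X i)) {a b : ℤ} (hb : b < n) (hab : IsConcentrated P.obj a b)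
    (φ : (BoundedComplex.toDb 𝒞).obj P ⟶ ((Db.single 𝒞).obj N)⟦(1 : ℤ)⟧) :
    ∃ (P' : BoundedComplex 𝒜)
      (q : (BoundedComplex.toDb 𝒞).obj P ⟶ (BoundedComplex.toDb 𝒞).obj P')
      (ψ : (BoundedComplex.toDb 𝒞).obj P' ⟶ ((Db.single 𝒞).obj N)⟦(1 : ℤ)⟧),
      (∀ i, 𝒞 (P'.obj.X i)) ∧ (∀ i, 0 ≤ i → IsZero (P'.obj.X i)) ∧ φ = q ≫ ψ := by
  induction n generalizing b P with
  | zero => exact ⟨P, 𝟙 _, φ, hP, fun i hi => hab i (by lia), (Category.id_comp φ).symm⟩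
  | succ n ih =>
    by_cases hb0 : b < 0
    · exact ⟨P, 𝟙 _, φ, hP, fun i hi => hab i (by lia), (Category.id_comp φ).symm⟩
    obtain ⟨P₁, f, g, h, hT, hP₁, e⟩ := exists_distinguished_single (𝒞 := 𝒞) P hab
    obtain ⟨φ', rfl⟩ : ∃ φ' : (BoundedComplex.toDb 𝒞).obj P₁ ⟶ ((Db.single 𝒞).obj N)⟦(1 : ℤ)⟧,
        φ = g ≫ φ' :=
      Triangle.yoneda_exact₂ _ hT φ (Db.hom_single_eq_zero (hP b) N (by lia) _)
    obtain ⟨P', q, ψ, h₁, h₂, rfl⟩ := ih P₁ (fun i => by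
      obtain h | ⟨⟨e⟩⟩ := e i
      · exact 𝒞.prop_of_isZero h
      · exact 𝒞.prop_of_iso e (hP i)) (b := b - 1) (by lia) hP₁ φ'
    exact ⟨P', g ≫ q, ψ, h₁, h₂, (Category.assoc _ _ _).symm⟩

variable [𝒞.IsClosedUnderBinaryProducts]

lemma Db.sub_toDb {P : BoundedComplex 𝒜} (hP : ∀ i, 𝒞 (P.obj.X i)) :
    Db.sub 𝒞 ((BoundedComplex.toDb 𝒞).obj P) :=
  ⟨⟨(BoundedComplex.toKb 𝒜).obj P, (HomotopyCategory.quotient _ _).obj P.obj, ⟨P.property, hP⟩,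
    ⟨Iso.refl _⟩⟩, ⟨Iso.refl _⟩⟩

lemma Db.sub_exists_iso {X : Db 𝒞} (hX : Db.sub 𝒞 X) :
    ∃ P : BoundedComplex 𝒜, (∀ i, 𝒞 (P.obj.X i)) ∧
      Nonempty (X ≅ (BoundedComplex.toDb 𝒞).obj P) := by
  obtain ⟨⟨Y, Z, ⟨h₁, h₂⟩, ⟨e⟩⟩, ⟨e'⟩⟩ := hX
  exact ⟨⟨Z.as, h₁⟩, h₂, ⟨e'.symm ≪≫ (Db.Q 𝒞).mapIso ((Kb.ι 𝒜).preimageIso e)⟩⟩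

variable [HasEpiApproximations 𝒞]

lemma Db.exists_factorization {N : 𝒜} {X : Db 𝒞} (hX : Db.sub 𝒞 X)
    (φ : X ⟶ ((Db.single 𝒞).obj N)⟦(1 : ℤ)⟧) :
    ∃ (Y : Db 𝒞) (q : X ⟶ Y) (ψ : Y ⟶ ((Db.single 𝒞).obj N)⟦(1 : ℤ)⟧), Db.sub 𝒞 Y ∧ φ = q ≫ ψ ∧
      ∀ (M : 𝒜) (_ : gorenstein 𝒞 M) (χ : (Db.single 𝒞).obj M ⟶ Y), χ = 0 := by
  obtain ⟨P, hP, ⟨e⟩⟩ := Db.sub_exists_iso hX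
  obtain ⟨a, b, hab⟩ := P.property
  obtain ⟨P', q, ψ, h₁, h₂, h⟩ := Db.exists_factorization_of_complex
    (b + 1).toNat P hP (by lia) hab (e.inv ≫ φ)
  refine ⟨_, e.hom ≫ q, ψ, Db.sub_toDb h₁, ?_, fun M hM => Db.hom_eq_zero_of_gorenstein hM h₁ h₂⟩
  rw [Category.assoc, ← h, Iso.hom_inv_id_assoc]

variable {M N : 𝒜}

lemma Db.comp_eq_zero_of_sub (hM : gorenstein 𝒞 M) {X : Db 𝒞} (hX : Db.sub 𝒞 X)
    (φ : (Db.single 𝒞).obj M ⟶ X) (ψ : X ⟶ ((Db.single 𝒞).obj N)⟦(1 : ℤ)⟧) : φ ≫ ψ = 0 := by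
  obtain ⟨Y, q, ψ, -, rfl, h⟩ := Db.exists_factorization hX ψ
  rw [← Category.assoc, h M hM (φ ≫ q), zero_comp]

lemma Dsg.eq_zero_of_map_eq_zero (hM : gorenstein 𝒞 M)
    (φ : (Db.single 𝒞).obj M ⟶ ((Db.single 𝒞).obj N)⟦(1 : ℤ)⟧) (hφ : (Dsg.Q 𝒞).map φ = 0) :
    φ = 0 := by
  obtain ⟨X, s, hs, hsφ⟩ := (MorphismProperty.map_eq_iff_precomp (Dsg.Q 𝒞) (Db.sub 𝒞).trW φ 0).1
    (by rw [hφ, Functor.map_zero])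
  rw [comp_zero] at hsφ
  rw [ObjectProperty.trW_iff] at hs
  obtain ⟨P, g, h, hT, hP⟩ := hs
  obtain ⟨ψ, rfl⟩ : ∃ ψ : P ⟶ ((Db.single 𝒞).obj N)⟦(1 : ℤ)⟧, φ = g ≫ ψ :=
    Triangle.yoneda_exact₂ _ hT φ hsφ
  exact Db.comp_eq_zero_of_sub hM hP g ψ

lemma Dsg.map_surjective (hM : gorenstein 𝒞 M)
    (φ : (Dsg.Q 𝒞).obj ((Db.single 𝒞).obj M) ⟶ (Dsg.Q 𝒞).obj ((Db.single 𝒞).obj N)) :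
    ∃ ψ, (Dsg.Q 𝒞).map ψ = φ := by
  obtain ⟨@⟨Y, f, s, hs⟩, rfl⟩ := Localization.exists_leftFraction (Dsg.Q 𝒞) (Db.sub 𝒞).trW φ
  obtain ⟨P, g, h, hT, hP⟩ := (ObjectProperty.trW_iff _ _).1 hs
  obtain ⟨P', q, h', hP', rfl, hzero⟩ := Db.exists_factorization hP h
  obtain ⟨Y', s', g', hT'⟩ := distinguished_cocone_triangle₂ h'
  have hs' : (Db.sub 𝒞).trW s' := (ObjectProperty.trW_iff _ _).2 ⟨_, _, _, hT', hP'⟩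
  have hqh : (q ≫ h') ≫ (𝟙 ((Db.single 𝒞).obj N))⟦(1 : ℤ)⟧' = q ≫ h' := by
    rw [CategoryTheory.Functor.map_id, Category.comp_id]
  obtain ⟨y, hy, -⟩ : ∃ y : Y ⟶ Y', s ≫ y = 𝟙 _ ≫ s' ∧ g ≫ q = y ≫ g' :=
    complete_distinguished_triangle_morphism₂ _ _ hT hT' (𝟙 _) q hqh
  rw [Category.id_comp] at hy
  obtain ⟨k, hk⟩ : ∃ k : (Db.single 𝒞).obj M ⟶ (Db.single 𝒞).obj N, f ≫ y = k ≫ s' :=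
    Triangle.coyoneda_exact₂ _ hT' (f ≫ y) (hzero M hM _)
  have := Localization.inverts (Dsg.Q 𝒞) _ _ hs
  have hQ : IsIso ((Dsg.Q 𝒞).map s') := Localization.inverts (Dsg.Q 𝒞) _ _ hs'
  have hφ := MorphismProperty.LeftFraction.map_comp_map_s ⟨f, s, hs⟩ (Dsg.Q 𝒞)
    (Localization.inverts (Dsg.Q 𝒞) (Db.sub 𝒞).trW)
  refine ⟨k, (cancel_mono ((Dsg.Q 𝒞).map s')).1 ?_⟩
  rw [← Functor.map_comp, ← hk, ← hy, Functor.map_comp, Functor.map_comp, reassoc_of% hφ]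

end GorensteinOrthogonality

/-! ### The relative singularity category -/

lemma VerdierQuotient.isZero_obj {T : Type u} [Category.{v} T] [HasZeroObject T] [HasShift T ℤ]
    [Preadditive T] [∀ n : ℤ, (shiftFunctor T n).Additive] [Pretriangulated T] [IsTriangulated T]
    (P : ObjectProperty T) [P.IsTriangulated] {X : T} (hX : P X) :
    IsZero ((VerdierQuotient.Q P).obj X) := by
  have h : P.trW (0 : 0 ⟶ X) := ⟨_, _, _, contractible_distinguished₁ X, hX⟩
  have := Localization.inverts (VerdierQuotient.Q P) _ _ h
  exact ((VerdierQuotient.Q P).map_isZero (isZero_zero T)).of_iso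
    (asIso ((VerdierQuotient.Q P).map (0 : 0 ⟶ X))).symm

lemma isStableUnderShift_of_shift_one {T : Type*} [Category* T] [HasShift T ℤ]
    (E : ObjectProperty T) [E.IsClosedUnderIsomorphisms] (h : ∀ X, E X → E (X⟦(1 : ℤ)⟧))
    (h' : ∀ X, E X → E (X⟦(-1 : ℤ)⟧)) : E.IsStableUnderShift ℤ where
  isStableUnderShiftBy n := ⟨fun X hX => by
    rw [ObjectProperty.prop_shift_iff]
    induction n using Int.induction_on with
    | zero => exact E.prop_of_iso ((shiftFunctorZero T ℤ).symm.app X) hX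
    | succ n ih => exact E.prop_of_iso ((shiftFunctorAdd' T (n : ℤ) 1 _ rfl).symm.app X) (h _ ih)
    | pred n ih =>
      exact E.prop_of_iso ((shiftFunctorAdd' T (-n : ℤ) (-1) _ rfl).symm.app X) (h' _ ih)⟩

lemma Db.prop_toDb_single_iff (E : ObjectProperty (Db 𝒞)) [E.IsStableUnderShift ℤ]
    [E.IsClosedUnderIsomorphisms] (M : 𝒜) (n : ℤ) :
    E ((BoundedComplex.toDb 𝒞).obj ((BoundedComplex.single 𝒜 n).obj M)) ↔
      E ((Db.single 𝒞).obj M) := by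
  rw [E.prop_iff_of_iso (Db.singleIso 𝒞 M (-n) n (by lia)),
    E.prop_shift_iff_of_isStableUnderShift]

lemma exists_hasProperResolutionOfLength {P : ObjectProperty 𝒜} {M : 𝒜}
    (hM : properDim 𝒞 P M < ⊤) : ∃ n, HasProperResolutionOfLength 𝒞 P M n := by
  by_contra! h
  simp [properDim, h] at hM

section Singularity

variable [𝒞.ContainsZero] [𝒞.IsClosedUnderIsomorphisms] [𝒞.IsClosedUnderBinaryProducts]

variable (𝒞) in
/-- The functor `𝒜 ⥤ D_{𝒞-sg}(𝒜)`. -/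
abbrev Dsg.single : 𝒜 ⥤ Dsg 𝒞 := Db.single 𝒞 ⋙ Dsg.Q 𝒞

instance : (theta 𝒞).Additive where
  map_add {_ _ f g} := (Dsg.single 𝒞).map_add (f := f.hom) (g := g.hom)

lemma Dsg.isZero_single {X : 𝒜} (hX : 𝒞.retractClosure X) : IsZero ((Dsg.single 𝒞).obj X) := by
  obtain ⟨C, hC, ⟨r⟩⟩ := hX
  have : IsZero ((Dsg.single 𝒞).obj C) := VerdierQuotient.isZero_obj (Db.sub 𝒞)
    (Db.sub_toDb (P := (BoundedComplex.single 𝒜 0).obj C) (prop_single_X hC 0))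
  exact this.of_mono (r.map (Dsg.single 𝒞)).i

section ConnectingMorphism

variable {S S' : ShortComplex 𝒜}

/-- The connecting morphism in `D_{𝒞-sg}(𝒜)` of a proper short exact sequence. -/
def Dsg.δ (hS : IsProper 𝒞 S) :
    (Dsg.single 𝒞).obj S.X₃ ⟶ ((Dsg.single 𝒞).obj S.X₁)⟦(1 : ℤ)⟧ :=
  (Dsg.Q 𝒞).map (Db.δ hS) ≫ ((Dsg.Q 𝒞).commShiftIso (1 : ℤ)).hom.app _

lemma Dsg.distinguished (hS : IsProper 𝒞 S) :
    Triangle.mk ((Dsg.single 𝒞).map S.f) ((Dsg.single 𝒞).map S.g) (Dsg.δ hS) ∈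
      distTriang (Dsg 𝒞) :=
  (Dsg.Q 𝒞).map_distinguished _ (Db.distinguished hS)

lemma Dsg.δ_naturality (hS : IsProper 𝒞 S) (hS' : IsProper 𝒞 S') (φ : S ⟶ S') :
    (Dsg.single 𝒞).map φ.τ₃ ≫ Dsg.δ hS' = Dsg.δ hS ≫ ((Dsg.single 𝒞).map φ.τ₁)⟦(1 : ℤ)⟧' := by
  calc
    _ = (Dsg.Q 𝒞).map ((Db.single 𝒞).map φ.τ₃ ≫ Db.δ hS') ≫
          ((Dsg.Q 𝒞).commShiftIso (1 : ℤ)).hom.app _ := by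
        rw [Functor.map_comp, Category.assoc]; rfl
    _ = (Dsg.Q 𝒞).map (Db.δ hS) ≫ (Dsg.Q 𝒞).map (((Db.single 𝒞).map φ.τ₁)⟦(1 : ℤ)⟧') ≫
          ((Dsg.Q 𝒞).commShiftIso (1 : ℤ)).hom.app _ := by
        rw [Db.δ_naturality hS hS' φ, Functor.map_comp, Category.assoc]
    _ = _ := by
        rw [Functor.commShiftIso_hom_naturality, Dsg.δ, Category.assoc]; rfl

lemma Dsg.isIso_δ (hS : IsProper 𝒞 S) (h₂ : 𝒞.retractClosure S.X₂) : IsIso (Dsg.δ hS) :=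
  (Triangle.isZero₂_iff_isIso₃ _ (Dsg.distinguished hS)).1 (Dsg.isZero_single h₂)

/-- The suspension of `S.X₁` as computed by a proper short exact sequence whose middle term vanishes
in `D_{𝒞-sg}(𝒜)`. The sign is the one that makes the triangle of a push-out distinguished, see
`Dsg.distinguished_pushout`. -/
def Dsg.suspIso (hS : IsProper 𝒞 S) (h₂ : 𝒞.retractClosure S.X₂) :
    (Dsg.single 𝒞).obj S.X₃ ≅ ((Dsg.single 𝒞).obj S.X₁)⟦(1 : ℤ)⟧ :=
  have := Dsg.isIso_δ hS h₂;
  -asIso (Dsg.δ hS)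

lemma Dsg.suspIso_hom (hS : IsProper 𝒞 S) (h₂ : 𝒞.retractClosure S.X₂) :
    (Dsg.suspIso hS h₂).hom = -Dsg.δ hS := rfl

lemma Dsg.suspIso_hom_naturality (hS : IsProper 𝒞 S) (h₂ : 𝒞.retractClosure S.X₂)
    (hS' : IsProper 𝒞 S') (h₂' : 𝒞.retractClosure S'.X₂) (φ : S ⟶ S') :
    (Dsg.single 𝒞).map φ.τ₃ ≫ (Dsg.suspIso hS' h₂').hom =
      (Dsg.suspIso hS h₂).hom ≫ ((Dsg.single 𝒞).map φ.τ₁)⟦(1 : ℤ)⟧' := by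
  rw [suspIso_hom, suspIso_hom, Preadditive.comp_neg, Dsg.δ_naturality hS hS' φ,
    Preadditive.neg_comp]

lemma Dsg.distinguished_pushout (hS : IsProper 𝒞 S) (h₂ : 𝒞.retractClosure S.X₂) {M Z : 𝒜}
    {u : S.X₁ ⟶ M} {b : S.X₂ ⟶ Z} {v : M ⟶ Z} (sq : IsPushout S.f u b v) {w : Z ⟶ S.X₃}
    (hb : b ≫ w = S.g) (hv : v ≫ w = 0) :
    Triangle.mk ((Dsg.single 𝒞).map u) ((Dsg.single 𝒞).map v)
      ((Dsg.single 𝒞).map w ≫ (Dsg.suspIso hS h₂).hom) ∈ distTriang (Dsg 𝒞) := by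
  have hT : IsProper 𝒞 (ShortComplex.mk v w hv) := hS.pushout sq hb hv
  let φ : S ⟶ ShortComplex.mk v w hv := 
    { τ₁ := u, τ₂ := b, τ₃ := 𝟙 _, comm₁₂ := sq.w.symm, comm₂₃ := by simp [hb] }
  have hδ : Dsg.δ hT = Dsg.δ hS ≫ ((Dsg.single 𝒞).map u)⟦(1 : ℤ)⟧' := by
    simpa [φ] using Dsg.δ_naturality hS hT φ
  rw [Pretriangulated.rotate_distinguished_triangle]
  refine mem_distTriang_of_iso₃ (Dsg.distinguished hT) (Dsg.suspIso hS h₂) rfl ?_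
  exact (Preadditive.neg_comp_neg _ _).trans hδ.symm

end ConnectingMorphism

variable [HasEpiApproximations 𝒞]

variable (𝒞) in
lemma theta_full : (theta 𝒞).Full where
  map_surjective {X Y} φ := by
    have := Db.single_full (𝒞 := 𝒞)
    obtain ⟨ψ, rfl⟩ := Dsg.map_surjective X.property φ
    obtain ⟨f, rfl⟩ := (Db.single 𝒞).map_surjective ψ
    exact ⟨ObjectProperty.homMk f, rfl⟩

lemma Dsg.exists_factorization_of_map_eq_zero {X Y : 𝒜} (hX : gorenstein 𝒞 X) (f : X ⟶ Y)
    (hf : (Dsg.single 𝒞).map f = 0) : ∃ (C : 𝒜) (a : X ⟶ C) (b : C ⟶ Y), 𝒞 C ∧ a ≫ b = f := by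
  have := Db.single_full (𝒞 := 𝒞)
  have := Db.single_faithful (𝒞 := 𝒞)
  obtain ⟨Q, N, i, p, h, hQ, hN, hS, -⟩ := hX.hasCosyzygyIn
  have hf' : (Dsg.Q 𝒞).map (((Db.single 𝒞).map f)⟦(1 : ℤ)⟧') = 0 := by
    replace hf : (Dsg.Q 𝒞).map ((Db.single 𝒞).map f) = 0 := hf
    rw [← cancel_mono (((Dsg.Q 𝒞).commShiftIso (1 : ℤ)).hom.app _),
      Functor.commShiftIso_hom_naturality, hf, Functor.map_zero, comp_zero, zero_comp]
  have hδ : Db.δ hS ≫ ((Db.single 𝒞).map f)⟦(1 : ℤ)⟧' = 0 :=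
    Dsg.eq_zero_of_map_eq_zero hN _ (by rw [Functor.map_comp, hf', comp_zero])
  obtain ⟨ψ, hψ⟩ : ∃ ψ : ((Db.single 𝒞).obj Q)⟦(1 : ℤ)⟧ ⟶ ((Db.single 𝒞).obj Y)⟦(1 : ℤ)⟧,
      ((Db.single 𝒞).map f)⟦(1 : ℤ)⟧' = (-((Db.single 𝒞).map i)⟦(1 : ℤ)⟧') ≫ ψ :=
    Triangle.yoneda_exact₃ _ (rot_of_distTriang _ (Db.distinguished hS)) _ hδ
  obtain ⟨ψ, rfl⟩ := (shiftFunctor (Db 𝒞) (1 : ℤ)).map_surjective ψ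
  obtain ⟨b, rfl⟩ := (Db.single 𝒞).map_surjective ψ
  refine ⟨Q, i, -b, hQ, (Db.single 𝒞).map_injective
    ((shiftFunctor (Db 𝒞) (1 : ℤ)).map_injective ?_)⟩
  rw [hψ]
  simp only [Functor.map_comp, Functor.map_neg, Preadditive.comp_neg, Preadditive.neg_comp]

lemma theta_map_eq_iff {X Y : (gorenstein 𝒞).FullSubcategory} (f g : X ⟶ Y) :
    (theta 𝒞).map f = (theta 𝒞).map g ↔ stableRel (gorensteinConflations 𝒞) f g := by
  rw [← sub_eq_zero, ← Functor.map_sub]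
  refine ⟨fun h => ?_, fun ⟨P, a, b, hP, h⟩ => ?_⟩
  · obtain ⟨C, a, b, hC, hab⟩ :=
      Dsg.exists_factorization_of_map_eq_zero X.property (f - g).hom h
    exact ⟨⟨C, le_gorenstein_self 𝒞 _ hC⟩, ObjectProperty.homMk a, ObjectProperty.homMk b,
      isRelProjective_gorensteinConflations_iff.2 (𝒞.le_retractClosure _ hC),
      by ext; exact hab.symm⟩
  · rw [isRelProjective_gorensteinConflations_iff] at hP
    have ha : (theta 𝒞).map a = 0 := (Dsg.isZero_single hP).eq_of_tgt _ _
    rw [h, Functor.map_comp, ha, zero_comp]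

section EssentialImage

variable {X : Dsg 𝒞}

lemma theta_essImage_shift (hX : (theta 𝒞).essImage X) : (theta 𝒞).essImage (X⟦(1 : ℤ)⟧) := by
  obtain ⟨M, ⟨e⟩⟩ := hX
  obtain ⟨Q, N, i, p, h, hQ, hN, hS, -⟩ := gorenstein.hasCosyzygyIn M.property
  exact ⟨⟨N, hN⟩, ⟨Dsg.suspIso hS (𝒞.le_retractClosure _ hQ) ≪≫
    (shiftFunctor (Dsg 𝒞) (1 : ℤ)).mapIso e⟩⟩

lemma theta_essImage_shift_neg (hX : (theta 𝒞).essImage X) :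
    (theta 𝒞).essImage (X⟦(-1 : ℤ)⟧) := by
  obtain ⟨M, ⟨e⟩⟩ := hX
  obtain ⟨K, P, i, p, h, hK, hP, hS, -⟩ := gorenstein.hasSyzygyIn M.property
  exact ⟨⟨K, hK⟩, ⟨(shiftShiftNeg ((Dsg.single 𝒞).obj K) (1 : ℤ)).symm ≪≫
    (shiftFunctor (Dsg 𝒞) (-1 : ℤ)).mapIso
      ((Dsg.suspIso hS (𝒞.le_retractClosure _ hP)).symm ≪≫ e)⟩⟩

lemma theta_essImage_obj₃ (T : Triangle (Dsg 𝒞)) (hT : T ∈ distTriang (Dsg 𝒞))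
    (h₁ : (theta 𝒞).essImage T.obj₁) (h₂ : (theta 𝒞).essImage T.obj₂) :
    (theta 𝒞).essImage T.obj₃ := by
  obtain ⟨X, ⟨e₁⟩⟩ := h₁
  obtain ⟨M, ⟨e₂⟩⟩ := h₂
  have := theta_full 𝒞
  obtain ⟨u, hu⟩ := (theta 𝒞).map_surjective (e₁.hom ≫ T.mor₁ ≫ e₂.inv)
  replace hu : (theta 𝒞).map u ≫ e₂.hom = e₁.hom ≫ T.mor₁ := by simp [hu]
  obtain ⟨I, Y, i, p, h, hI, hY, hS, -⟩ := gorenstein.hasCosyzygyIn X.property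
  obtain ⟨Z, b, v, w, hv, sq, hb, hZ⟩ := hS.exists_pushout u.hom
  have hZ : gorenstein 𝒞 Z := IsClosedUnderProperExtensions.of_isProper hZ M.property hY
  exact ⟨⟨Z, hZ⟩, ⟨Triangle.π₃.mapIso (isoTriangleOfIso₁₂ _ _
    (Dsg.distinguished_pushout hS (𝒞.le_retractClosure _ hI) sq hb hv) hT e₁ e₂ hu)⟩⟩

variable (𝒞) in
lemma isTriangulated_essImage_theta : (theta 𝒞).essImage.IsTriangulated where
  exists_zero := ⟨_, Dsg.isZero_single (𝒞.le_retractClosure _ 𝒞.prop_zero),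
    (theta 𝒞).obj_mem_essImage ⟨0, le_gorenstein_self 𝒞 _ 𝒞.prop_zero⟩⟩
  toIsStableUnderShift := isStableUnderShift_of_shift_one _ (fun _ => theta_essImage_shift)
    (fun _ => theta_essImage_shift_neg)
  toIsTriangulatedClosed₂ :=
    have : (theta 𝒞).essImage.IsStableUnderShift ℤ := isStableUnderShift_of_shift_one _
      (fun _ => theta_essImage_shift) (fun _ => theta_essImage_shift_neg)
    have : (theta 𝒞).essImage.IsTriangulatedClosed₃ := .mk' theta_essImage_obj₃
    .of_isTriangulatedClosed₃

lemma theta_essImage_single {M : 𝒜} (hM : properDim 𝒞 (gorenstein 𝒞) M < ⊤) :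
    (theta 𝒞).essImage ((Dsg.single 𝒞).obj M) := by
  have := isTriangulated_essImage_theta 𝒞
  let E := (theta 𝒞).essImage.inverseImage (Dsg.Q 𝒞)
  have hE {G : 𝒜} (hG : gorenstein 𝒞 G) (i : ℤ) :
      E ((BoundedComplex.toDb 𝒞).obj ((BoundedComplex.single 𝒜 i).obj G)) :=
    (Db.prop_toDb_single_iff E G i).2 ((theta 𝒞).obj_mem_essImage ⟨G, hG⟩)
  obtain ⟨n, K, hK, ⟨e⟩, hKG, hK0⟩ := exists_hasProperResolutionOfLength hM
  let K' : BoundedComplex 𝒜 := ⟨K, -n, 1, hK0⟩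
  obtain ⟨L, f, g, δ, hT, hL, hLK⟩ := exists_distinguished_single (𝒞 := 𝒞) K' hK0
  have hLG (i : ℤ) : gorenstein 𝒞 (L.obj.X i) := by
    by_cases hi : -(n : ℤ) ≤ i ∧ i ≤ 0
    · obtain h | ⟨⟨e⟩⟩ := hLK i
      · exact (gorenstein 𝒞).prop_of_isZero h
      · exact (gorenstein 𝒞).prop_of_iso e (hKG i hi.1 hi.2)
    · exact (gorenstein 𝒞).prop_of_isZero (hL i (by lia))
  have hK' : E ((BoundedComplex.toDb 𝒞).obj K') := E.prop_of_isZero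
    (VerdierQuotient.isZero_obj (Kb.acyclic 𝒞) (X := (BoundedComplex.toKb 𝒜).obj K') hK)
  have hK₁ := E.ext_of_isTriangulatedClosed₁ _ hT hK'
    (BoundedComplex.prop_toDb E L fun i => hE (hLG i) i)
  exact E.prop_of_iso ((Db.single 𝒞).mapIso e) ((Db.prop_toDb_single_iff E _ 1).1 hK₁)

lemma theta_essSurj (hdim : ∀ M, properDim 𝒞 (gorenstein 𝒞) M < ⊤) : (theta 𝒞).EssSurj where
  mem_essImage X := by
    have := isTriangulated_essImage_theta 𝒞
    have := Localization.essSurj (Dsg.Q 𝒞) (Db.sub 𝒞).trW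
    have := Localization.essSurj (Db.Q 𝒞) (Kb.acyclic 𝒞).trW
    let E := (theta 𝒞).essImage.inverseImage (Dsg.Q 𝒞)
    obtain ⟨K, hK⟩ := BoundedComplex.toKb_obj_surjective
      ((Db.Q 𝒞).objPreimage ((Dsg.Q 𝒞).objPreimage X))
    have hE : E ((BoundedComplex.toDb 𝒞).obj K) := BoundedComplex.prop_toDb E K fun i =>
      (Db.prop_toDb_single_iff E _ i).2 (theta_essImage_single (hdim _))
    exact (theta 𝒞).essImage.prop_of_iso ((Dsg.Q 𝒞).mapIso ((Db.Q 𝒞).mapIso (eqToIso hK) ≪≫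
      (Db.Q 𝒞).objObjPreimageIso _) ≪≫ (Dsg.Q 𝒞).objObjPreimageIso X) hE

end EssentialImage

end Singularity

/-! ### Transport of triangulated structures -/

section Transport

variable {C D : Type*} [Category* C] [Category* D] [HasZeroObject C] [HasZeroObject D]
  [Preadditive C] [Preadditive D] [HasShift D ℤ] [∀ n : ℤ, (shiftFunctor D n).Additive]
  [Pretriangulated D]

instance : ObjectProperty.IsTriangulated (C := D) IsZero where
  exists_zero := ⟨0, isZero_zero D, isZero_zero D⟩
  isStableUnderShiftBy n := ⟨fun _ hX => (shiftFunctor D n).map_isZero hX⟩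
  toIsTriangulatedClosed₂ := .mk' fun T hT h₁ h₃ => T.isZero₂_of_isZero₁₃ hT h₁ h₃

variable (D) in
lemma trW_isZero_le : ObjectProperty.trW (C := D) IsZero ≤ MorphismProperty.isomorphisms D :=
  fun _ _ _ ⟨_, _, _, hT, hZ⟩ => (Triangle.isZero₃_iff_isIso₁ _ hT).1 hZ

lemma exists_isTriangulated_of_equivalence [IsTriangulated D] (E : C ≌ D) [E.functor.Additive] :
    ∃ (_ : HasShift C ℤ) (_ : ∀ n : ℤ, (shiftFunctor C n).Additive) (_ : Pretriangulated C)
      (_ : E.functor.CommShift ℤ), IsTriangulated C ∧ E.functor.IsTriangulated := by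
  -- `E.inverse` is a localization of `D` at the isomorphisms, and localizations of triangulated
  -- categories are triangulated.
  let W := ObjectProperty.trW (C := D) IsZero
  have : E.inverse.IsLocalization W := .of_isEquivalence _ _ (trW_isZero_le D)
  let : HasShift C ℤ := HasShift.localized E.inverse W ℤ
  let : E.inverse.CommShift ℤ := Functor.CommShift.localized E.inverse W ℤ
  have (n : ℤ) : (shiftFunctor C n).Additive := by
    rw [Localization.functor_additive_iff E.inverse W]
    exact Functor.additive_of_iso (E.inverse.commShiftIso n)
  let : Pretriangulated C := Triangulated.Localization.pretriangulated E.inverse W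
  have h : E.inverse.IsTriangulated :=
    Triangulated.Localization.isTriangulated_functor E.inverse W
  let : E.functor.CommShift ℤ := E.commShiftFunctor ℤ
  have := E.commShift_of_inverse ℤ
  have h' := Equivalence.IsTriangulated.mk'' E h
  exact ⟨inferInstance, inferInstance, inferInstance, inferInstance,
    Triangulated.Localization.isTriangulated E.inverse W, h'.leftAdjoint_isTriangulated⟩

lemma exists_isTriangulated_of_isEquivalence [IsTriangulated D] (F : C ⥤ D) [F.IsEquivalence]
    [h : F.Additive] :
    ∃ (_ : HasShift C ℤ) (_ : ∀ n : ℤ, (shiftFunctor C n).Additive) (_ : Pretriangulated C)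
      (_ : F.CommShift ℤ), IsTriangulated C ∧ F.IsTriangulated :=
  have : F.asEquivalence.functor.Additive := h
  exists_isTriangulated_of_equivalence F.asEquivalence

end Transport

section PreimageShiftIso

variable {C D : Type*} [Category* C] [Category* D] [HasShift C ℤ] [HasShift D ℤ]
  (F : C ⥤ D) [F.Full] [F.Faithful] [F.CommShift ℤ] {X X' Y Y' Z : C}
  (e : F.obj X ≅ (F.obj Y)⟦(1 : ℤ)⟧) (e' : F.obj X' ≅ (F.obj Y')⟦(1 : ℤ)⟧)

/-- The isomorphism to a shift which corresponds to a given one under a fully faithful functor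
commuting with the shifts. -/
def preimageShiftIso : X ≅ Y⟦(1 : ℤ)⟧ :=
  F.preimageIso (e ≪≫ ((F.commShiftIso (1 : ℤ)).app Y).symm)

lemma map_preimageShiftIso_hom :
    F.map (preimageShiftIso F e).hom ≫ (F.commShiftIso (1 : ℤ)).hom.app Y = e.hom := by
  simp [preimageShiftIso]

lemma preimageShiftIso_hom_naturality {f : X ⟶ X'} {g : Y ⟶ Y'}
    (h : F.map f ≫ e'.hom = e.hom ≫ (F.map g)⟦(1 : ℤ)⟧') :
    f ≫ (preimageShiftIso F e').hom = (preimageShiftIso F e).hom ≫ g⟦(1 : ℤ)⟧' := by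
  apply F.map_injective
  rw [← cancel_mono ((F.commShiftIso (1 : ℤ)).hom.app _), Functor.map_comp, Functor.map_comp,
    Category.assoc, Category.assoc, map_preimageShiftIso_hom, h,
    Functor.commShiftIso_hom_naturality, ← Category.assoc, map_preimageShiftIso_hom]

lemma mem_distTriang_preimageShiftIso [HasZeroObject C] [HasZeroObject D] [Preadditive C]
    [Preadditive D] [∀ n : ℤ, (shiftFunctor C n).Additive]
    [∀ n : ℤ, (shiftFunctor D n).Additive] [Pretriangulated C] [Pretriangulated D]
    [F.IsTriangulated] {u : Y ⟶ Y'} {v : Y' ⟶ Z} {w : Z ⟶ X}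
    (hT : Triangle.mk (F.map u) (F.map v) (F.map w ≫ e.hom) ∈ distTriang D) :
    Triangle.mk u v (w ≫ (preimageShiftIso F e).hom) ∈ distTriang C := by
  rw [← map_preimageShiftIso_hom F e, ← Functor.map_comp_assoc] at hT
  exact (F.map_distinguished_iff _).1 hT

end PreimageShiftIso

/-! ### Happel's triangulation and the equivalence -/

section Happel

variable {B : Type u} [Category.{v} B] [Preadditive B] {ε : ObjectProperty (ShortComplex B)}

lemma IsFrobenius.exists_isPushout (hε : IsFrobenius ε) {X M : B} (u : X ⟶ M) :
    ∃ (I Y Z : B) (i : X ⟶ I) (p : I ⟶ Y) (h : i ≫ p = 0) (b : I ⟶ Z) (v : M ⟶ Z) (w : Z ⟶ Y),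
      ε (ShortComplex.mk i p h) ∧ IsRelInjective ε I ∧ IsPushout i u b v ∧ b ≫ w = p ∧
        v ≫ w = 0 := by
  obtain ⟨I, i, hI, Y, p, h, hS⟩ := hε.enough_injectives X
  obtain ⟨Z, b, v, sq, -⟩ := hε.exact.pushout_inflation i u ⟨Y, p, h, hS⟩
  exact ⟨I, Y, Z, i, p, h, b, v, sq.desc p 0 (by rw [h, comp_zero]), hS, hI, sq,
    sq.inl_desc _ _ _, sq.inr_desc _ _ _⟩

variable [HasZeroObject B] [HasBinaryBiproducts B] [HasShift (StableCategory ε) ℤ]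
  [∀ n : ℤ, (shiftFunctor (StableCategory ε) n).Additive] [Pretriangulated (StableCategory ε)]

/-- A triangulation of the stable category whose suspension is given by the conflations with
injective middle term is Happel's as soon as the standard triangles are distinguished: every
morphism is then the base of a standard triangle. -/
def happelTriangulation (hε : IsFrobenius ε)
    (σ : ∀ (S : ShortComplex B) (_ : ε S) (_ : IsRelInjective ε S.X₂),
      (stableQuotient ε).obj S.X₃ ≅ ((stableQuotient ε).obj S.X₁)⟦(1 : ℤ)⟧)
    (naturality : ∀ {S S' : ShortComplex B} (hS : ε S) (hI : IsRelInjective ε S.X₂)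
      (hS' : ε S') (hI' : IsRelInjective ε S'.X₂) (φ : S ⟶ S'),
      (stableQuotient ε).map φ.τ₃ ≫ (σ S' hS' hI').hom =
        (σ S hS hI).hom ≫ ((stableQuotient ε).map φ.τ₁)⟦(1 : ℤ)⟧')
    (standard : ∀ {S : ShortComplex B} (hS : ε S) (hI : IsRelInjective ε S.X₂) {M Z : B}
      {u : S.X₁ ⟶ M} {v : M ⟶ Z} {b : S.X₂ ⟶ Z} {w : Z ⟶ S.X₃},
      IsPushout S.f u b v → b ≫ w = S.g → v ≫ w = 0 →
        Triangle.mk ((stableQuotient ε).map u) ((stableQuotient ε).map v)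
          ((stableQuotient ε).map w ≫ (σ S hS hI).hom) ∈ distTriang (StableCategory ε)) :
    HappelTriangulation ε where
  suspIso := σ
  suspIso_naturality _ _ := naturality
  distinguished_iff T := by
    refine ⟨fun hT => ?_, fun ⟨_, hS, hI, _, _, _, _, _, _, sq, hb, hv, ⟨e⟩⟩ =>
      isomorphic_distinguished _ (standard hS hI sq hb hv) _ e⟩
    obtain ⟨u, hu⟩ := (stableQuotient ε).map_surjective (X := T.obj₁.as) (Y := T.obj₂.as) T.mor₁
    obtain ⟨I, Y, Z, i, p, h, b, v, w, hS, hI, sq, hb, hv⟩ := hε.exists_isPushout u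
    refine ⟨_, hS, hI, T.obj₂.as, Z, u, v, b, w, sq, hb, hv,
      ⟨isoTriangleOfIso₁₂ _ _ hT (standard hS hI sq hb hv) (Iso.refl _)
        (Iso.refl _) ?_⟩⟩
    exact (Category.comp_id _).trans (hu.symm.trans (Category.id_comp _).symm)

end Happel

section Equivalence

variable [𝒞.ContainsZero] [𝒞.IsClosedUnderIsomorphisms] [𝒞.IsClosedUnderBinaryProducts]
  [HasEpiApproximations 𝒞]

variable (𝒞) in
/-- The functor `θ'` induced by `θ` on the stable category. -/
abbrev stableTheta : StableCategory (gorensteinConflations 𝒞) ⥤ Dsg 𝒞 :=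
  CategoryTheory.Quotient.lift (stableRel (gorensteinConflations 𝒞)) (theta 𝒞)
    fun _ _ f g h => (theta_map_eq_iff f g).2 h

instance : (stableTheta 𝒞).Full where
  map_surjective {X Y} φ := by
    have := theta_full 𝒞
    obtain ⟨f, hf⟩ := (theta 𝒞).map_surjective (X := X.as) (Y := Y.as) φ
    exact ⟨(stableQuotient _).map f, hf⟩

instance : (stableTheta 𝒞).Faithful where
  map_injective {X Y} f g hfg := by
    obtain ⟨f, rfl⟩ := (stableQuotient _).map_surjective (X := X.as) (Y := Y.as) f
    obtain ⟨g, rfl⟩ := (stableQuotient _).map_surjective (X := X.as) (Y := Y.as) g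
    exact CategoryTheory.Quotient.sound _ ((theta_map_eq_iff f g).1 hfg)

instance : (stableTheta 𝒞).Additive where
  map_add {X Y f g} := by
    obtain ⟨f, rfl⟩ := (stableQuotient _).map_surjective (X := X.as) (Y := Y.as) f
    obtain ⟨g, rfl⟩ := (stableQuotient _).map_surjective (X := X.as) (Y := Y.as) g
    rw [← Functor.map_add]
    exact (theta 𝒞).map_add

lemma stableTheta_isEquivalence (hdim : ∀ M, properDim 𝒞 (gorenstein 𝒞) M < ⊤) :
    (stableTheta 𝒞).IsEquivalence where
  essSurj := ⟨fun X => by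
    have := theta_essSurj hdim
    exact ⟨(stableQuotient _).obj ((theta 𝒞).objPreimage X), ⟨(theta 𝒞).objObjPreimageIso X⟩⟩⟩

variable [HasShift (StableCategory (gorensteinConflations 𝒞)) ℤ]
  [∀ n : ℤ, (shiftFunctor (StableCategory (gorensteinConflations 𝒞)) n).Additive]
  [Pretriangulated (StableCategory (gorensteinConflations 𝒞))]

variable (𝒞) in
/-- Happel's description of any triangulation of the stable category for which `θ'` is
triangulated, obtained from the connecting isomorphisms `Dsg.suspIso`. -/
def stableThetaHappelTriangulation [(stableTheta 𝒞).CommShift ℤ] [(stableTheta 𝒞).IsTriangulated] :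
    HappelTriangulation (gorensteinConflations 𝒞) :=
  have proper {S} (hS : gorensteinConflations 𝒞 S) := (gorensteinConflations_iff S).1 hS
  have retract {I} (hI : IsRelInjective (gorensteinConflations 𝒞) I) :=
    isRelInjective_gorensteinConflations_iff.1 hI
  happelTriangulation (isFrobenius_gorensteinConflations 𝒞)
    (fun _ hS hI => preimageShiftIso (stableTheta 𝒞) (Dsg.suspIso (proper hS) (retract hI)))
    (fun hS hI hS' hI' φ => preimageShiftIso_hom_naturality _ _ _ <|
      Dsg.suspIso_hom_naturality (proper hS) (retract hI) (proper hS') (retract hI')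
        ((gorenstein 𝒞).ι.mapShortComplex.map φ))
    (fun hS hI _ _ _ _ _ _ sq hb hv => mem_distTriang_preimageShiftIso _ _ <|
      Dsg.distinguished_pushout (proper hS) (retract hI)
        (properConflations.isPushout_hom (proper hS) sq)
        (congr_arg (·.hom) hb) (congr_arg (·.hom) hv))

end Equivalence

end RelSing

end

theorem theorem4p12_general {𝒜 : Type u} [Category.{v} 𝒜] [Abelian 𝒜] (𝒞 : ObjectProperty 𝒜)
    [𝒞.ContainsZero] [𝒞.IsClosedUnderBinaryProducts] [𝒞.IsClosedUnderIsomorphisms]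
    (hfin : IsContravariantlyFinite 𝒞) (hadm : IsAdmissible 𝒞)
    (hdim : ∀ M, properDim 𝒞 (gorenstein 𝒞) M < ⊤) :
    IsFrobenius (gorensteinConflations 𝒞) ∧
    ∃ hθ : ∀ (X Y : (gorenstein 𝒞).FullSubcategory) (f g : X ⟶ Y),
        stableRel (gorensteinConflations 𝒞) f g →
          (theta 𝒞).map f = (theta 𝒞).map g,
      ∃ (_ : HasShift (StableCategory (gorensteinConflations 𝒞)) ℤ)
        (_ : ∀ n : ℤ, (shiftFunctor
          (StableCategory (gorensteinConflations 𝒞)) n).Additive)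
        (_ : Pretriangulated (StableCategory (gorensteinConflations 𝒞))),
        IsTriangulated (StableCategory (gorensteinConflations 𝒞)) ∧
        Nonempty (HappelTriangulation (gorensteinConflations 𝒞)) ∧
        IsTriangleEquivalence
          (CategoryTheory.Quotient.lift (stableRel (gorensteinConflations 𝒞))
            (theta 𝒞) hθ) := by
  have := hfin.hasEpiApproximations hadm
  have := stableTheta_isEquivalence hdim
  obtain ⟨shift, shiftAdditive, pretriangulated, commShift, isTriangulated, thetaTriangulated⟩ :=
    exists_isTriangulated_of_isEquivalence (stableTheta 𝒞)
  exact ⟨isFrobenius_gorensteinConflations 𝒞, fun _ _ f g h => (theta_map_eq_iff f g).2 h, shift,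
    shiftAdditive, pretriangulated, isTriangulated, ⟨stableThetaHappelTriangulation 𝒞⟩,
    inferInstance, commShift, thetaTriangulated⟩

theorem theorem4p12 {k : Type w} {A : Type u} [Field k] [Ring A] [Algebra k A]
    [FiniteDimensional k A] (𝒞 : ObjectProperty (FDModuleCat k A))
    [𝒞.ContainsZero] [𝒞.IsClosedUnderBinaryProducts] [𝒞.IsStableUnderRetracts]
    (hfin : IsContravariantlyFinite 𝒞) (hadm : IsAdmissible 𝒞)
    (hdim : properGlobalDim 𝒞 (gorenstein 𝒞) < ⊤) :
    IsFrobenius (gorensteinConflations 𝒞) ∧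
    ∃ hθ : ∀ (X Y : (gorenstein 𝒞).FullSubcategory) (f g : X ⟶ Y),
        stableRel (gorensteinConflations 𝒞) f g →
          (theta 𝒞).map f = (theta 𝒞).map g,
      ∃ (_ : HasShift (StableCategory (gorensteinConflations 𝒞)) ℤ)
        (_ : ∀ n : ℤ, (shiftFunctor
          (StableCategory (gorensteinConflations 𝒞)) n).Additive)
        (_ : Pretriangulated (StableCategory (gorensteinConflations 𝒞))),
        IsTriangulated (StableCategory (gorensteinConflations 𝒞)) ∧
        Nonempty (HappelTriangulation (gorensteinConflations 𝒞)) ∧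
        IsTriangleEquivalence
          (CategoryTheory.Quotient.lift (stableRel (gorensteinConflations 𝒞))
            (theta 𝒞) hθ) :=
  theorem4p12_general 𝒞 hfin hadm
    fun M => (le_iSup (properDim 𝒞 (gorenstein 𝒞)) M).trans_lt hdim
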